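/- Let $K$ be an algebraically closed field of characteristic zero, and let $a,b,c$ be positive integers with $\gcd(a,b,c)=1$ and $a\ge b$. Let $\varGamma$ be the $\mathbb Z$-grading of $K[x,y,z]$ with $\deg x=a$, $\deg y=b$, $\deg z=-c$, and let $\mathrm{Aut}_\varGamma$ be the group of all $K$-algebra automorphisms that map each homogeneous component into itself. An automorphism is written as the tuple of images of the variables, and as the corresponding polynomial map; $\circ$ is composition of polynomial maps, $(F\circ G)(p)=F(G(p))$. An automorphism of $K[x,y,z]$ is elementary if it sends one variable $x_i$ to $\lambda x_i+F$, with $\lambda\in K^\times$ and $F$ a polynomial in the other two variables, and fixes the other two variables. Assume that $\varGamma$ admits graded wild automorphisms, i.e. that some element of $\mathrm{Aut}_\varGamma$ is not a composition of elementary automorphisms belonging to $\mathrm{Aut}_\varGamma$. Let $\mathrm E=\{\varphi\in \mathrm{Aut}_\varGamma : \varphi(z)=z\}$, $\mathrm T=\{(x,y,\lambda z) : \lambda\in K^\times\}$, and let $\alpha:\mathrm E\to \mathrm{Aut}(K[u,v])$ be the homomorphism $\alpha(f,g,z)=(f(u,v,1),g(u,v,1))$. Give $K[u,v]$ the $\mathbb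 Z/c$-grading with $\deg u=a \bmod c$, $\deg v=b\bmod c$, and put $$D=\{(u,\lambda v+u^k) : \lambda\in K^\times,\ k\ge 1,\ ka\equiv b \ (\mathrm{mod}\ c)\},$$ $$U=\{(\lambda u+f(v),v) : \lambda\in K^\times,\ f(v) \text{ homogeneous of degree } a \bmod c,\ q\ge a/b \text{ for every monomial } v^q \text{ of } f\},$$ $$W=\{(\lambda u+f(v),v) : \lambda\in K^\times,\ f(v) \text{ homogeneous of degree } a \bmod c,\ 1<q<a/b \text{ for every monomial } v^q \text{ of } f\}$$ ($f=0$ is allowed in $U$ and in $W$). Then: 1. $\alpha$ is injective, and $U\subseteq\alpha(\mathrm E)$. 2. For all $\tau\in W$ and $\theta\in D$ there is $s\in W$ with $s\circ\tau^{-1}\circ\theta\circ\tau\in\alpha(\mathrm E)$. 3. For every choice of such an $s=s_{\tau,\theta}$ for each pair $(\tau,\theta)\in W\times D$, put $\tau_\theta=s_{\tau,\theta}\circ\tau^{-1}$. Then the group $\mathrm{Aut}_\varGamma$ is generated by $\alpha^{-1}(U)$, the automorphisms $\alpha^{-1}(\tau_\theta\circ\theta\circ\tau)$ with $\tau\in W$,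 $\theta\in D$, and $\mathrm T$. 4. If $(a,b,c)=(3,1,1)$, there are $\tau\in W$, $\theta\in D$ for which the identity is an admissible choice of $s_{\tau,\theta}$ and $\alpha^{-1}(\tau^{-1}\circ\theta\circ\tau)$ is the Nagata automorphism $$\bigl(x-2y(xz+y^2)-z(xz+y^2)^2,\ y+z(xz+y^2),\ z\bigr).$$ -/

import Mathlib

namespace GradedAut

open MvPolynomial

/-- Automorphisms of the `K`-algebra `K[x,y,z]`, with `x = X 0`, `y = X 1`, `z = X 2`.
The triple notation `(f,g,h)` stands for the automorphism `x ↦ f`, `y ↦ g`, `z ↦ h`. -/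
abbrev Aut3 (K : Type*) [Field K] := MvPolynomial (Fin 3) K ≃ₐ[K] MvPolynomial (Fin 3) K

/-- Automorphisms of the `K`-algebra `K[u,v]`, with `u = X 0`, `v = X 1`. -/
abbrev Aut2 (K : Type*) [Field K] := MvPolynomial (Fin 2) K ≃ₐ[K] MvPolynomial (Fin 2) K

/-- The degrees `(a, b, -c)` of `(x, y, z)`. -/
def deg3 (a b c : ℕ) : Fin 3 → ℤ := ![(a : ℤ), (b : ℤ), -(c : ℤ)]

/-- The degrees of `(u, v)` in `ℤ/c`: the residues of `a` and `b`. -/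
def deg2 (a b c : ℕ) : Fin 2 → ZMod c := ![(a : ZMod c), (b : ZMod c)]

/-- The homogeneous component of degree `n` of the grading `Γ` of `K[x,y,z]`. -/
def component (K : Type*) [Field K] (a b c : ℕ) (n : ℤ) : Submodule K (MvPolynomial (Fin 3) K) :=
  weightedHomogeneousSubmodule K (deg3 a b c) n

theorem symm_mem_component {K : Type*} [Field K] {a b c : ℕ} {φ : Aut3 K}
    (h : ∀ n, ∀ p ∈ component K a b c n, φ p ∈ component K a b c n) (n : ℤ)
    (p : MvPolynomial (Fin 3) K) (hp : p ∈ component K a b c n) :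
    φ.symm p ∈ component K a b c n := by
  classical
  set w := deg3 a b c
  have key : ∀ q : MvPolynomial (Fin 3) K,
      weightedHomogeneousComponent w n (φ q) = φ (weightedHomogeneousComponent w n q) := by
    intro q
    have hq := sum_weightedHomogeneousComponent w q
    have hfin := weightedHomogeneousComponent_finsupp (w := w) q
    rw [finsum_eq_sum _ hfin] at hq
    conv_lhs => rw [← hq]
    rw [map_sum, map_sum]
    have hterm : ∀ m ∈ hfin.toFinset,
        weightedHomogeneousComponent w n (φ (weightedHomogeneousComponent w m q))
          = if m = n then φ (weightedHomogeneousComponent w n q) else 0 := by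
      intro m _
      have hm : (φ (weightedHomogeneousComponent w m q)).IsWeightedHomogeneous w m :=
        h m _ (weightedHomogeneousComponent_isWeightedHomogeneous (w := w) (n := m) q)
      split_ifs with hmn
      · subst hmn
        exact hm.weightedHomogeneousComponent_same
      · exact hm.weightedHomogeneousComponent_ne n (Ne.symm hmn)
    rw [Finset.sum_congr rfl hterm, Finset.sum_ite_eq']
    split_ifs with hn
    · rfl
    · have : weightedHomogeneousComponent w n q = 0 := by
        by_contra hne
        exact hn (hfin.mem_toFinset.2 hne)
      rw [this, map_zero]
  have hp' : p.IsWeightedHomogeneous w n := hp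
  have h1 := key (φ.symm p)
  rw [AlgEquiv.apply_symm_apply, hp'.weightedHomogeneousComponent_same] at h1
  rw [h1, AlgEquiv.symm_apply_apply]
  exact weightedHomogeneousComponent_isWeightedHomogeneous (w := w) (n := n) _

/-- The group `Aut_Γ(K[x,y,z])` of `Γ`-graded automorphisms. -/
def gradedAut (K : Type*) [Field K] (a b c : ℕ) : Subgroup (Aut3 K) where
  carrier := {φ | ∀ n, ∀ p ∈ component K a b c n, φ p ∈ component K a b c n}
  one_mem' := fun _ _ hp => hp
  mul_mem' := fun hφ hψ n p hp => hφ n _ (hψ n p hp)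
  inv_mem' := fun hφ => symm_mem_component hφ

/-- Elementary automorphisms of `K[x,y,z]`: one variable `x_i` is sent to `l x_i + F`, where
`l ≠ 0` and `F` does not involve `x_i`, and the other variables are fixed. -/
def IsElementary {K : Type*} [Field K] (φ : Aut3 K) : Prop :=
  ∃ (i : Fin 3) (l : K) (F : MvPolynomial (Fin 3) K), l ≠ 0 ∧ i ∉ F.vars ∧
    φ (X i) = C l * X i + F ∧ ∀ j, j ≠ i → φ (X j) = X j

/-- Compositions of graded elementary automorphisms. -/
def IsGradedTame {K : Type*} [Field K] (a b c : ℕ) (φ : Aut3 K) : Prop :=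
  φ ∈ Submonoid.closure {ψ : Aut3 K | ψ ∈ gradedAut K a b c ∧ IsElementary ψ}

/-- The grading admits graded wild automorphisms. -/
def AdmitsGradedWild (K : Type*) [Field K] (a b c : ℕ) : Prop :=
  ∃ φ ∈ gradedAut K a b c, ¬ IsGradedTame a b c φ

/-- The group `E` of graded automorphisms that fix `z`. -/
def groupE (K : Type*) [Field K] (a b c : ℕ) : Subgroup (Aut3 K) where
  carrier := {φ | φ ∈ gradedAut K a b c ∧ φ (X 2) = X 2}
  one_mem' := ⟨one_mem _, rfl⟩
  mul_mem' := fun {φ ψ} hφ hψ => ⟨mul_mem hφ.1 hψ.1, by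
    rw [AlgEquiv.mul_apply, hψ.2, hφ.2]⟩
  inv_mem' := fun {φ} hφ => ⟨inv_mem hφ.1, by
    change φ.symm (X 2) = X 2
    rw [AlgEquiv.symm_apply_eq, hφ.2]⟩

/-- The set `T` of the automorphisms `(x, y, l z)` with `l ≠ 0`. -/
def torusT (K : Type*) [Field K] : Set (Aut3 K) :=
  {φ | ∃ l : K, l ≠ 0 ∧ φ (X 0) = X 0 ∧ φ (X 1) = X 1 ∧ φ (X 2) = C l * X 2}

/-- Restriction of functions to the plane `z = 1`: `p ↦ p(u, v, 1)`. -/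
noncomputable def restrict (K : Type*) [Field K] :
    MvPolynomial (Fin 3) K →ₐ[K] MvPolynomial (Fin 2) K :=
  aeval ![X 0, X 1, 1]

/-- The endomorphism `u ↦ f(u,v,1)`, `v ↦ g(u,v,1)` attached to `φ = (f, g, h)`. -/
noncomputable def alphaHom {K : Type*} [Field K] (φ : Aut3 K) :
    MvPolynomial (Fin 2) K →ₐ[K] MvPolynomial (Fin 2) K :=
  aeval ![restrict K (φ (X 0)), restrict K (φ (X 1))]

theorem alphaHom_restrict {K : Type*} [Field K] {φ : Aut3 K} (h : φ (X 2) = X 2)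
    (p : MvPolynomial (Fin 3) K) : alphaHom φ (restrict K p) = restrict K (φ p) := by
  have : (alphaHom φ).comp (restrict K) = (restrict K).comp (φ : _ →ₐ[K] _) := by
    apply MvPolynomial.algHom_ext
    intro i
    fin_cases i <;> simp [alphaHom, restrict, h]
  exact DFunLike.congr_fun this p

theorem alphaHom_comp {K : Type*} [Field K] {φ : Aut3 K} (h : φ (X 2) = X 2) (ψ : Aut3 K) :
    (alphaHom φ).comp (alphaHom ψ) = alphaHom (φ * ψ) := by
  apply MvPolynomial.algHom_ext
  intro i
  have h0 : ∀ χ : Aut3 K, alphaHom χ (X 0) = restrict K (χ (X 0)) := fun χ => by simp [alphaHom]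
  have h1 : ∀ χ : Aut3 K, alphaHom χ (X 1) = restrict K (χ (X 1)) := fun χ => by simp [alphaHom]
  fin_cases i
  · change alphaHom φ (alphaHom ψ (X 0)) = alphaHom (φ * ψ) (X 0)
    rw [h0, h0, alphaHom_restrict h]; rfl
  · change alphaHom φ (alphaHom ψ (X 1)) = alphaHom (φ * ψ) (X 1)
    rw [h1, h1, alphaHom_restrict h]; rfl

theorem alphaHom_one {K : Type*} [Field K] :
    alphaHom (1 : Aut3 K) = AlgHom.id K (MvPolynomial (Fin 2) K) := by
  apply MvPolynomial.algHom_ext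
  intro i
  fin_cases i <;> simp [alphaHom, restrict]

/-- The homomorphism `α : E → Aut(K[u,v])`, `α(f, g, z) = (f(u,v,1), g(u,v,1))`. -/
noncomputable def alpha (K : Type*) [Field K] (a b c : ℕ) : groupE K a b c →* Aut2 K where
  toFun φ := AlgEquiv.ofAlgHom (alphaHom φ.1) (alphaHom (φ.1)⁻¹)
    (by rw [alphaHom_comp φ.2.2, mul_inv_cancel, alphaHom_one])
    (by rw [alphaHom_comp (inv_mem φ.2).2, inv_mul_cancel, alphaHom_one])
  map_one' := by
    ext1 i
    exact DFunLike.congr_fun alphaHom_one i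
  map_mul' φ ψ := by
    ext1 p
    exact (DFunLike.congr_fun (alphaHom_comp φ.2.2 ψ.1) p).symm

/-- The preimage `α⁻¹(Z)`, as a set of automorphisms of `K[x,y,z]`. -/
def lifts (K : Type*) [Field K] (a b c : ℕ) (Z : Set (Aut2 K)) : Set (Aut3 K) :=
  Subtype.val '' (alpha K a b c ⁻¹' Z)

/-- The polynomial `f(v)` in `K[u,v]`. -/
noncomputable def atV {K : Type*} [Field K] (f : Polynomial K) : MvPolynomial (Fin 2) K :=
  Polynomial.aeval (X 1) f

/-- `D`: the automorphisms `(u, l v + u^k)` with `k ≥ 1`, `k a ≡ b (mod c)`, `l ≠ 0`. -/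
def setD (K : Type*) [Field K] (a b c : ℕ) : Set (Aut2 K) :=
  {θ | ∃ (l : K) (k : ℕ), l ≠ 0 ∧ 1 ≤ k ∧ k * a ≡ b [MOD c] ∧
    θ (X 0) = X 0 ∧ θ (X 1) = C l * X 1 + X 0 ^ k}

/-- `U`: the automorphisms `(l u + f(v), v)` with `l ≠ 0`, `f(v)` homogeneous of degree `a mod c`,
and all monomials `v^q` of `f` satisfying `q ≥ a / b`. -/
def setU (K : Type*) [Field K] (a b c : ℕ) : Set (Aut2 K) :=
  {τ | ∃ (l : K) (f : Polynomial K), l ≠ 0 ∧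
    (atV f).IsWeightedHomogeneous (deg2 a b c) (a : ZMod c) ∧
    (∀ q ∈ f.support, (a : ℚ) / b ≤ q) ∧
    τ (X 0) = C l * X 0 + atV f ∧ τ (X 1) = X 1}

/-- `W`: the automorphisms `(l u + f(v), v)` with `l ≠ 0`, `f(v)` homogeneous of degree `a mod c`,
and all monomials `v^q` of `f` satisfying `1 < q < a / b`. -/
def setW (K : Type*) [Field K] (a b c : ℕ) : Set (Aut2 K) :=
  {τ | ∃ (l : K) (f : Polynomial K), l ≠ 0 ∧
    (atV f).IsWeightedHomogeneous (deg2 a b c) (a : ZMod c) ∧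
    (∀ q ∈ f.support, 1 < q ∧ (q : ℚ) < (a : ℚ) / b) ∧
    τ (X 0) = C l * X 0 + atV f ∧ τ (X 1) = X 1}

/-- The automorphism `s ∘ τ⁻¹ ∘ θ ∘ τ`, where `∘` is the composition of polynomial maps of the
plane, so `(F ∘ G)(p) = F (G p)` for points `p`. On the algebra, the map `F ∘ G` acts by first
applying `F` and then `G`, that is, as `F.trans G = G * F`. -/
noncomputable def corrected {K : Type*} [Field K] (s τ θ : Aut2 K) : Aut2 K :=
  ((s.trans τ.symm).trans θ).trans τ

/-- `s` is a correction for `(τ, θ)`: `s ∈ W` and `s ∘ τ⁻¹ ∘ θ ∘ τ` lifts to `K[x,y,z]`. -/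
def IsCorrection {K : Type*} [Field K] (a b c : ℕ) (s τ θ : Aut2 K) : Prop :=
  s ∈ setW K a b c ∧ corrected s τ θ ∈ (alpha K a b c).range

/-- The set `S` of all `τ_θ ∘ θ ∘ τ = s_{τ,θ} ∘ τ⁻¹ ∘ θ ∘ τ` with `τ ∈ W`, `θ ∈ D`, for a given
choice `(τ, θ) ↦ s_{τ,θ}`. -/
def setS (K : Type*) [Field K] (a b c : ℕ) (s : Aut2 K → Aut2 K → Aut2 K) : Set (Aut2 K) :=
  {ψ | ∃ τ ∈ setW K a b c, ∃ θ ∈ setD K a b c, ψ = corrected (s τ θ) τ θ}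

/-- `φ` is the Nagata automorphism
`(x - 2 y (x z + y²) - z (x z + y²)², y + z (x z + y²), z)`. -/
def IsNagata {K : Type*} [Field K] (φ : Aut3 K) : Prop :=
  φ (X 0) = X 0 - 2 * X 1 * (X 0 * X 2 + X 1 ^ 2) - X 2 * (X 0 * X 2 + X 1 ^ 2) ^ 2 ∧
  φ (X 1) = X 1 + X 2 * (X 0 * X 2 + X 1 ^ 2) ∧
  φ (X 2) = X 2

end GradedAut

namespace GradedAut

open MvPolynomial

/-! ### Leading forms with respect to integer weights -/

section Weights

variable {σ τ R M : Type*}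

/-! Setting z = 1 loses nothing on a homogeneous component. A polynomial of degree n is recovered
from its restriction, and p(u,v) is such a restriction exactly when each of its monomials u^i v^j
satisfies ai + bj ≥ n and ai + bj ≡ n mod c. So E becomes a group of plane automorphisms cut out by
congruences and inequalities. Since b ≤ a, the only inequality with content beyond fixing the origin
is that the image of u contains no v^j with jb < a (`isLiftable_of_mem_originGroup`).

Let G be `originGroup`; it contains α(E), U, W and D. Three facts about G carry the theorem.

A graded form of Jung's theorem: G is generated by U, W and D (`originGroup_le_elemMonoid`). The
translation v ↦ v + t conjugated by ψ is a polynomial family that fixes F = ψ(u). Passing to leading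
parts gives a nontrivial family fixing the leading form F' (`exists_limit`). Over K(u,v) this is a
nonconstant polynomial arc along which F', hence every factor of F', is constant (`exists_arc`). Two
distinct factors u^q - r v^p, or a single one with p, q ≥ 2 (by Mason–Stothers), would make the arc
constant. So F' = c(u^q - l v^p)^g with p = 1 or q = 1 (`exists_topForm`), and an elementary
automorphism lowers the bidegree of F. Homogeneity of F gives qa ≡ pb mod c, which makes this
automorphism graded.

Corrections: each element of G becomes liftable after multiplication by an element of W
(`exists_liftable_mul`), because the forbidden powers of v can be removed one at a time.

Rigidity: an element of W that lifts is a scaling (lu, v) (`eq_elemU_zero_of_liftable`).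

Moving the factors from W to the right in a product of elements of U, W and D turns each θ in D into
a generator from S, so G ⊆ ⟨U, S⟩ W (`elemMonoid_subset_mul`). For an element of α(E) the remaining
factor from W also lies in α(E), so it is a scaling and belongs to U. The torus T accounts for φ(z)
= lz. Wildness serves only to provide k ≥ 1 with ka ≡ b, so that D is nonempty. -/

theorem isWeightedHomogeneous_aeval [CommSemiring R] [AddCommMonoid M] {w : σ → M} {w' : τ → M}
    {g : σ → MvPolynomial τ R} (hg : ∀ i, (g i).IsWeightedHomogeneous w' (w i))
    {p : MvPolynomial σ R} {n : M} (hp : p.IsWeightedHomogeneous w n) :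
    (aeval g p).IsWeightedHomogeneous w' n := by
  rw [aeval_def, eval₂_eq]
  refine IsWeightedHomogeneous.sum _ _ _ fun d hd => ?_
  rw [← hp (mem_support_iff.1 hd), Finsupp.weight_apply, Finsupp.sum]
  exact (IsWeightedHomogeneous.prod _ _ _ fun i _ => (hg i).pow (d i)).C_mul _

/-- All monomials of `f` have weight at most `n`. -/
def WeightAtMost [CommSemiring R] (w : σ → ℤ) (n : ℤ) (f : MvPolynomial σ R) : Prop :=
  ∀ d, coeff d f ≠ 0 → Finsupp.weight w d ≤ n

namespace WeightAtMost

variable [CommRing R] {w : σ → ℤ} {w' : τ → ℤ} {n m : ℤ} {f g : MvPolynomial σ R}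

theorem mono (hf : WeightAtMost w n f) (h : n ≤ m) : WeightAtMost w m f :=
  fun d hd => (hf d hd).trans h

theorem zero : WeightAtMost w n (0 : MvPolynomial σ R) := fun d hd => by simp at hd

theorem add (hf : WeightAtMost w n f) (hg : WeightAtMost w n g) : WeightAtMost w n (f + g) := by
  intro d hd
  by_cases h : coeff d f = 0
  · exact hg d (by simpa [h] using hd)
  · exact hf d h

theorem mul (hf : WeightAtMost w n f) (hg : WeightAtMost w m g) :
    WeightAtMost w (n + m) (f * g) := by
  classical
  intro d hd
  obtain ⟨e₁, h₁, e₂, h₂, rfl⟩ := Finset.mem_add.1 (support_mul f g (mem_support_iff.2 hd))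
  rw [map_add]
  exact add_le_add (hf _ (mem_support_iff.1 h₁)) (hg _ (mem_support_iff.1 h₂))

theorem of_homogeneous (hf : f.IsWeightedHomogeneous w n) : WeightAtMost w n f :=
  fun _ hd => (hf hd).le

theorem sum {ι : Type*} (s : Finset ι) (F : ι → MvPolynomial σ R)
    (h : ∀ i ∈ s, WeightAtMost w n (F i)) : WeightAtMost w n (∑ i ∈ s, F i) := by
  classical
  induction s using Finset.induction_on with
  | empty => simpa using zero
  | insert i s hi ih =>
    rw [Finset.sum_insert hi]
    exact (h i (by simp)).add (ih fun j hj => h j (by simp [hj]))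

end WeightAtMost

/-- `f` has weight at most `n` and `f'` is its homogeneous component of degree `n`. -/
structure HasTop [CommRing R] (w : σ → ℤ) (n : ℤ) (f f' : MvPolynomial σ R) : Prop where
  homogeneous : f'.IsWeightedHomogeneous w n
  lower : WeightAtMost w (n - 1) (f - f')

namespace HasTop

variable [CommRing R] {w : σ → ℤ} {w' : τ → ℤ} {n m : ℤ} {f f' g g' : MvPolynomial σ R}

theorem weightAtMost (h : HasTop w n f f') : WeightAtMost w n f := by
  have := (h.lower.mono (show n - 1 ≤ n by lia)).add (.of_homogeneous h.homogeneous)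
  rwa [sub_add_cancel] at this

theorem of_homogeneous (h : f.IsWeightedHomogeneous w n) : HasTop w n f f :=
  ⟨h, by simpa using WeightAtMost.zero⟩

theorem of_weightAtMost (h : WeightAtMost w n f) :
    HasTop w n f (weightedHomogeneousComponent w n f) := by
  classical
  refine ⟨weightedHomogeneousComponent_isWeightedHomogeneous n f, fun d hd => ?_⟩
  rw [coeff_sub, coeff_weightedHomogeneousComponent] at hd
  split_ifs at hd with hw
  · simp at hd
  · have := h d (by simpa using hd)
    lia

theorem coeff_eq (h : HasTop w n f f') {d : σ →₀ ℕ} (hd : Finsupp.weight w d = n) :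
    coeff d f = coeff d f' := by
  by_contra hne
  have := h.lower d (by rw [coeff_sub]; exact sub_ne_zero.2 hne)
  lia

theorem unique (h : HasTop w n f f') (h' : HasTop w n f g') : f' = g' := by
  ext d
  by_cases hd : Finsupp.weight w d = n
  · rw [← h.coeff_eq hd, h'.coeff_eq hd]
  · rw [h.homogeneous.coeff_eq_zero d hd, h'.homogeneous.coeff_eq_zero d hd]

theorem add (h : HasTop w n f f') (h' : HasTop w n g g') : HasTop w n (f + g) (f' + g') :=
  ⟨h.homogeneous.add h'.homogeneous, by
    rw [add_sub_add_comm]; exact h.lower.add h'.lower⟩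

theorem add_lower (h : HasTop w n f f') (h' : WeightAtMost w (n - 1) g) :
    HasTop w n (f + g) f' :=
  ⟨h.homogeneous, by rw [add_sub_right_comm]; exact h.lower.add h'⟩

theorem mul (h : HasTop w n f f') (h' : HasTop w m g g') :
    HasTop w (n + m) (f * g) (f' * g') := by
  refine ⟨h.homogeneous.mul h'.homogeneous, ?_⟩
  have e : f * g - f' * g' = (f - f') * g + f' * (g - g') := by ring
  rw [e]
  exact ((h.lower.mul h'.weightAtMost).mono (by lia)).add
    (((WeightAtMost.of_homogeneous h.homogeneous).mul h'.lower).mono (by lia))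

theorem one : HasTop w 0 (1 : MvPolynomial σ R) 1 := of_homogeneous (isWeightedHomogeneous_one R w)

theorem C (r : R) : HasTop w 0 (C r : MvPolynomial σ R) (C r) :=
  of_homogeneous (isWeightedHomogeneous_C w r)

theorem pow (h : HasTop w n f f') (k : ℕ) : HasTop w (k • n) (f ^ k) (f' ^ k) := by
  induction k with
  | zero => simpa using one
  | succ k ih => rw [pow_succ, pow_succ, succ_nsmul]; exact ih.mul h

theorem prod {ι : Type*} (s : Finset ι) (F F' : ι → MvPolynomial σ R) (N : ι → ℤ)
    (h : ∀ i ∈ s, HasTop w (N i) (F i) (F' i)) :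
    HasTop w (∑ i ∈ s, N i) (∏ i ∈ s, F i) (∏ i ∈ s, F' i) := by
  classical
  induction s using Finset.induction_on with
  | empty => simpa using one
  | insert i s hi ih =>
    rw [Finset.sum_insert hi, Finset.prod_insert hi, Finset.prod_insert hi]
    exact (h i (by simp)).mul (ih fun j hj => h j (by simp [hj]))

theorem sum {ι : Type*} (s : Finset ι) (F F' : ι → MvPolynomial σ R)
    (h : ∀ i ∈ s, HasTop w n (F i) (F' i)) :
    HasTop w n (∑ i ∈ s, F i) (∑ i ∈ s, F' i) := by
  classical
  induction s using Finset.induction_on with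
  | empty => simpa using of_homogeneous (isWeightedHomogeneous_zero R w n)
  | insert i s hi ih =>
    rw [Finset.sum_insert hi, Finset.sum_insert hi]
    exact (h i (by simp)).add (ih fun j hj => h j (by simp [hj]))

variable {G G' : σ → MvPolynomial τ R}

theorem aeval_monomial (hG : ∀ i, HasTop w' (w i) (G i) (G' i)) (d : σ →₀ ℕ) (r : R) :
    HasTop w' (Finsupp.weight w d) (MvPolynomial.C r * ∏ i ∈ d.support, G i ^ d i)
      (MvPolynomial.C r * ∏ i ∈ d.support, G' i ^ d i) := by
  have := (C (w := w') r).mul (prod d.support _ _ _ fun i _ => (hG i).pow (d i))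
  rwa [zero_add] at this

theorem aeval_of_homogeneous (hG : ∀ i, HasTop w' (w i) (G i) (G' i))
    (hf : f.IsWeightedHomogeneous w n) : HasTop w' n (aeval G f) (aeval G' f) := by
  rw [aeval_def, aeval_def, eval₂_eq, eval₂_eq]
  refine sum _ _ _ fun d hd => ?_
  rw [← hf (mem_support_iff.1 hd)]
  exact aeval_monomial hG d _

theorem weightAtMost_aeval (hG : ∀ i, HasTop w' (w i) (G i) (G' i))
    (hf : WeightAtMost w n f) : WeightAtMost w' n (MvPolynomial.aeval G f) := by
  rw [aeval_def, eval₂_eq]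
  exact WeightAtMost.sum _ _ fun d hd =>
    (aeval_monomial hG d _).weightAtMost.mono (hf d (mem_support_iff.1 hd))

/-- Leading parts may cancel under substitution. This is harmless, because `HasTop` permits a zero
leading part. -/
theorem aeval (hG : ∀ i, HasTop w' (w i) (G i) (G' i)) (hf : HasTop w n f f') :
    HasTop w' n (aeval G f) (aeval G' f') := by
  have := (aeval_of_homogeneous hG hf.homogeneous).add_lower (weightAtMost_aeval hG hf.lower)
  rwa [← map_add, add_sub_cancel] at this

end HasTop

end Weights

/-! ### Degenerating a one-parameter family to its leading part -/

section Limit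

variable {K : Type*} [Field K]

/-- The inclusion of `K[u,v]` in `K[t,u,v]`. -/
noncomputable abbrev incl (K : Type*) [Field K] :
    MvPolynomial (Fin 2) K →ₐ[K] MvPolynomial (Fin 3) K :=
  rename Fin.succ

/-- The specialization `t = 0` of `K[t,u,v]`. -/
noncomputable def specialize (K : Type*) [Field K] :
    MvPolynomial (Fin 3) K →ₐ[K] MvPolynomial (Fin 2) K :=
  aeval (Fin.cons 0 X)

theorem specialize_incl (f : MvPolynomial (Fin 2) K) : specialize K (incl K f) = f := by
  simp only [specialize, aeval_rename]
  exact aeval_X_left_apply f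

theorem weight_cons (e : ℤ) (w : Fin 2 → ℤ) (d : Fin 3 →₀ ℕ) :
    Finsupp.weight (Fin.cons e w : Fin 3 → ℤ) d = d 0 * e + Finsupp.weight w d.tail := by
  simp [Finsupp.weight_apply, Finsupp.sum_fintype, Fin.sum_univ_succ, Finsupp.tail_apply]

theorem weight_smul (s : ℤ) (w : Fin 2 → ℤ) (d : Fin 2 →₀ ℕ) :
    Finsupp.weight (s • w) d = s * Finsupp.weight w d := by
  simp [Finsupp.weight_apply, Finsupp.sum_fintype, Fin.sum_univ_succ]
  ring

theorem coeff_specialize (f : MvPolynomial (Fin 3) K) (d : Fin 2 →₀ ℕ) :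
    coeff d (specialize K f) = coeff (d.cons 0) f := by
  induction f using MvPolynomial.induction_on' with
  | monomial e r =>
    rw [specialize, aeval_monomial, Finsupp.prod_fintype _ _ (by simp), Fin.prod_univ_succ,
      coeff_monomial]
    by_cases h : e 0 = 0
    · have : ∏ i : Fin 2, (Fin.cons 0 X : Fin 3 → MvPolynomial (Fin 2) K) i.succ ^ e i.succ
          = monomial e.tail 1 := by
        rw [monomial_eq, Finsupp.prod_fintype _ _ (by simp)]
        simp [Finsupp.tail_apply]
      rw [this, h, pow_zero, one_mul, algebraMap_eq, C_mul_monomial, coeff_monomial, mul_one]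
      have : e.tail = d ↔ e = d.cons 0 := by
        constructor
        · rintro rfl; rw [← h, Finsupp.cons_tail]
        · rintro rfl; rw [Finsupp.tail_cons]
      simp only [this]
    · rw [if_neg]
      · simp [h]
      · rintro rfl; exact h (by simp)
  | add f g hf hg => rw [map_add, coeff_add, hf, hg, coeff_add]

theorem HasTop.scale {s : ℤ} (hs : 0 < s) {w : Fin 2 → ℤ} {n : ℤ}
    {f f' : MvPolynomial (Fin 2) K} (h : HasTop w n f f') : HasTop (s • w) (s * n) f f' := by
  refine ⟨fun d hd => ?_, fun d hd => ?_⟩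
  · rw [weight_smul, h.homogeneous hd]
  · rw [weight_smul]
    have := h.lower d hd
    nlinarith

/-- The top part of a nontrivial one-parameter family of endomorphisms. -/
theorem exists_limit (E : MvPolynomial (Fin 2) K →ₐ[K] MvPolynomial (Fin 3) K)
    (hE0 : ∀ f, specialize K (E f) = f) (hE : E ≠ incl K) (w : Fin 2 → ℤ)
    {F F' : MvPolynomial (Fin 2) K} (hF : E F = incl K F) {n : ℤ} (hF' : HasTop w n F F') :
    ∃ L : MvPolynomial (Fin 2) K →ₐ[K] MvPolynomial (Fin 3) K,
      (∀ f, specialize K (L f) = f) ∧ L ≠ incl K ∧ L F' = incl K F' := by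
  classical
  -- At t = 0 the family is the identity, so the variable itself is the only monomial of its image
  -- that is free of t.
  have hX : ∀ i d, d 0 = 0 → coeff d (E (X i)) ≠ 0 → d = Finsupp.single i.succ 1 := by
    intro i d hd hc
    have h1 : coeff d.tail (specialize K (E (X i))) ≠ 0 := by
      rw [coeff_specialize, ← hd, Finsupp.cons_tail]; exact hc
    rw [hE0, coeff_X] at h1
    have h2 : Finsupp.single i 1 = d.tail := by
      by_contra h; simp [h] at h1
    rw [← Finsupp.cons_tail d, hd, ← h2]
    ext j
    refine Fin.cases ?_ (fun j => ?_) j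
    · simp
    · simp [Finsupp.single_apply]
  let S : Finset ((i : Fin 2) × (Fin 3 →₀ ℕ)) :=
    Finset.univ.sigma fun i => (E (X i)).support.filter fun d => d 0 ≠ 0
  have hS : S.Nonempty := by
    by_contra hS
    rw [Finset.not_nonempty_iff_eq_empty] at hS
    have hall : ∀ i d, coeff d (E (X i)) ≠ 0 → d 0 = 0 := by
      intro i d hc
      by_contra h0
      have : (⟨i, d⟩ : (i : Fin 2) × (Fin 3 →₀ ℕ)) ∈ S := by simp [S, hc, h0]
      simp [hS] at this
    apply hE
    ext1 i
    have h3 : E (X i) = monomial (Finsupp.single i.succ 1) (coeff (Finsupp.single i.succ 1) (E (X i))) := by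
      ext d
      rw [coeff_monomial]
      split_ifs with h
      · rw [h]
      · by_contra hc
        exact h (hX i d (hall i d hc) hc).symm
    have h4 := coeff_specialize (E (X i)) (Finsupp.single i 1)
    rw [hE0, coeff_X, if_pos rfl] at h4
    have h5 : (Finsupp.single i 1).cons 0 = (Finsupp.single i.succ 1 : Fin 3 →₀ ℕ) := by
      ext j
      refine Fin.cases ?_ (fun j => ?_) j
      · simp
      · simp [Finsupp.single_apply]
    rw [h5] at h4
    rw [h3, ← h4, rename_X]
    rfl
  -- The weight of t is minus the largest slope (w(d) - w i) / d 0. With this choice no monomial of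
  -- E (X i) exceeds the weight of X i, and some monomial involving t attains it. Scaling w by s =
  -- d₀ 0 keeps the weights integral.
  obtain ⟨⟨i₀, d₀⟩, hm, hmax⟩ := S.exists_max_image
    (fun x => ((Finsupp.weight w x.2.tail - w x.1 : ℤ) : ℚ) / (x.2 0 : ℚ)) hS
  simp only [S, Finset.mem_sigma, Finset.mem_univ, true_and, Finset.mem_filter,
    mem_support_iff] at hm
  obtain ⟨s, hs⟩ : ∃ s : ℤ, s = d₀ 0 := ⟨_, rfl⟩
  obtain ⟨e, he⟩ : ∃ e : ℤ, e = -(Finsupp.weight w d₀.tail - w i₀) := ⟨_, rfl⟩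
  have hs0 : 0 < s := by rw [hs]; exact_mod_cast Nat.pos_of_ne_zero hm.2
  let w' : Fin 3 → ℤ := Fin.cons e (s • w)
  have hw' : ∀ d : Fin 3 →₀ ℕ, Finsupp.weight w' d = d 0 * e + s * Finsupp.weight w d.tail := fun d => by
    rw [weight_cons, weight_smul]
  have hle : ∀ i, WeightAtMost w' ((s • w) i) (E (X i)) := by
    intro i d hd
    by_cases h0 : d 0 = 0
    · rw [hX i d h0 hd, Finsupp.weight_single]; simp [w']
    · have hmem : (⟨i, d⟩ : (i : Fin 2) × (Fin 3 →₀ ℕ)) ∈ S := by simp [S, hd, h0]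
      have h := hmax _ hmem
      have hd0 : (0 : ℚ) < d 0 := by exact_mod_cast Nat.pos_of_ne_zero h0
      have hd₀ : (0 : ℚ) < d₀ 0 := by exact_mod_cast Nat.pos_of_ne_zero hm.2
      simp only at h
      rw [div_le_div_iff₀ hd0 hd₀] at h
      have h' : (Finsupp.weight w d.tail - w i) * (d₀ 0 : ℤ)
          ≤ (Finsupp.weight w d₀.tail - w i₀) * (d 0 : ℤ) := by exact_mod_cast h
      rw [hw', Pi.smul_apply, smul_eq_mul, he, hs]
      linarith
  let G : Fin 2 → MvPolynomial (Fin 3) K := fun i =>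
    weightedHomogeneousComponent w' ((s • w) i) (E (X i))
  have hG : ∀ i, HasTop w' ((s • w) i) (E (X i)) (G i) := fun i => .of_weightAtMost (hle i)
  have hEa : ∀ f, aeval (fun i => E (X i)) f = E f := fun f =>
    (DFunLike.congr_fun (aeval_unique E) f).symm
  -- Setting t = 0 respects leading parts because 0 is homogeneous of every weight.
  have hsp : ∀ {n f f'}, HasTop w' n f f' →
      HasTop (s • w) n (specialize K f) (specialize K f') := by
    intro n f f' h
    refine HasTop.aeval (fun i => ?_) h
    refine Fin.cases ?_ (fun i => ?_) i
    · exact .of_homogeneous (isWeightedHomogeneous_zero _ _ _)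
    · exact .of_homogeneous (isWeightedHomogeneous_X _ _ _)
  have hin : ∀ {n f f'}, HasTop (s • w) n f f' → HasTop w' n (incl K f) (incl K f') := by
    intro n f f' h
    have : ∀ f, incl K f = aeval (fun i : Fin 2 => (X i.succ : MvPolynomial (Fin 3) K)) f :=
      DFunLike.congr_fun (show incl K = aeval _ by ext1 i; simp)
    rw [this, this]
    exact HasTop.aeval (fun i => .of_homogeneous (isWeightedHomogeneous_X _ _ i.succ)) h
  refine ⟨aeval G, fun f => ?_, fun h => ?_, ?_⟩
  · have : (specialize K).comp (aeval G) = AlgHom.id K _ := by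
      ext1 i
      have h1 := hsp (hG i)
      rw [hE0] at h1
      simpa using (h1.unique (.of_homogeneous (isWeightedHomogeneous_X K _ i)))
    exact DFunLike.congr_fun this f
  -- The extremal monomial d₀ survives in G i₀ and involves t, so the limit is not the inclusion.
  · have h1 := DFunLike.congr_fun h (X i₀)
    rw [aeval_X, rename_X] at h1
    have h2 := (hG i₀).coeff_eq (d := d₀) (by
      rw [hw', Pi.smul_apply, smul_eq_mul, he, hs]; ring)
    rw [h1, coeff_X, if_neg] at h2
    · exact hm.1 h2
    · intro h3
      apply hm.2
      rw [← h3]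
      simp
  · have h1 := HasTop.aeval hG (hF'.scale hs0)
    rw [hEa, hF] at h1
    exact h1.unique (hin (hF'.scale hs0))

end Limit

/-! ### Exponents in two variables -/

section Plane

/-- The exponent of `u^i v^j`. -/
noncomputable def expo (i j : ℕ) : Fin 2 →₀ ℕ := Finsupp.single 0 i + Finsupp.single 1 j

@[simp] theorem expo_zero (i j : ℕ) : expo i j 0 = i := by simp [expo]

@[simp] theorem expo_one (i j : ℕ) : expo i j 1 = j := by simp [expo]

theorem eq_expo (d : Fin 2 →₀ ℕ) : d = expo (d 0) (d 1) := by
  ext i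
  fin_cases i <;> simp

theorem weight_fin_two {M : Type*} [AddCommMonoid M] (w : Fin 2 → M) (d : Fin 2 →₀ ℕ) :
    Finsupp.weight w d = d 0 • w 0 + d 1 • w 1 := by
  simp [Finsupp.weight_apply, Finsupp.sum_fintype, Fin.sum_univ_two]

theorem monomial_expo {K : Type*} [CommSemiring K] (i j : ℕ) (r : K) :
    monomial (expo i j) r = C r * X 0 ^ i * X 1 ^ j := by
  rw [monomial_eq, Finsupp.prod_fintype _ _ (by simp), Fin.prod_univ_two]
  simp [mul_assoc]

theorem X_dvd_of_forall {σ R : Type*} [CommSemiring R] {i : σ} {f : MvPolynomial σ R}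
    (h : ∀ d, coeff d f ≠ 0 → d i ≠ 0) : X i ∣ f := by
  rw [f.as_sum]
  refine Finset.dvd_sum fun d hd => ?_
  rw [X_dvd_monomial]
  exact .inr (h d (mem_support_iff.1 hd))

theorem exists_coeff_degreeOf {σ R : Type*} [CommSemiring R] {f : MvPolynomial σ R} (hf : f ≠ 0)
    (i : σ) : ∃ d, coeff d f ≠ 0 ∧ d i = degreeOf i f := by
  rw [degreeOf_eq_sup]
  obtain ⟨d, hd, h⟩ := Finset.exists_mem_eq_sup f.support
    (Finset.nonempty_iff_ne_empty.2 (by simpa using hf)) (fun d => d i)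
  exact ⟨d, mem_support_iff.1 hd, h.symm⟩

theorem le_degreeOf {σ R : Type*} [CommSemiring R] {f : MvPolynomial σ R} {d : σ →₀ ℕ}
    (hd : coeff d f ≠ 0) (i : σ) : d i ≤ degreeOf i f := by
  rw [degreeOf_eq_sup]
  exact Finset.le_sup (f := fun d : σ →₀ ℕ => d i) (mem_support_iff.2 hd)

end Plane

theorem homogenize_prod_roots {R : Type*} [CommRing R] [Nontrivial R] (s : Multiset R) :
    ((s.map fun r => Polynomial.X - Polynomial.C r).prod).homogenize s.card =
      (s.map fun r => (X 0 - C r * X 1 : MvPolynomial (Fin 2) R)).prod := by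
  induction s using Multiset.induction_on with
  | empty => simp
  | cons a s ih =>
    rw [Multiset.map_cons, Multiset.prod_cons, Multiset.map_cons, Multiset.prod_cons,
      Multiset.card_cons, add_comm s.card 1, Polynomial.homogenize_mul, ih]
    · simp
    · simp
    · exact (Polynomial.natDegree_multiset_prod_X_sub_C_eq_card s).le

/-- A binomial curve with coprime exponents at least two has no polynomial parametrization. -/
theorem natDegree_eq_zero_of_binomial {L : Type*} [Field L] [CharZero L] {p q : ℕ} (hp : 2 ≤ p)
    (hq : 2 ≤ q) (hpq : Nat.Coprime p q) {f g : Polynomial L} {l k : L} (hl : l ≠ 0) (hk : k ≠ 0)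
    (h : f ^ q - Polynomial.C l * g ^ p = Polynomial.C k) :
    f.natDegree = 0 ∧ g.natDegree = 0 := by
  by_cases hf : f = 0
  · subst hf
    rw [zero_pow (by lia), zero_sub] at h
    have h1 : (Polynomial.C l * g ^ p).natDegree = 0 := by
      rw [← Polynomial.natDegree_neg, h, Polynomial.natDegree_C]
    rw [Polynomial.natDegree_C_mul hl, Polynomial.natDegree_pow] at h1
    refine ⟨by simp, ?_⟩
    rcases Nat.mul_eq_zero.1 h1 with h2 | h2 <;> lia
  by_cases hg : g = 0
  · subst hg
    rw [zero_pow (by lia), mul_zero, sub_zero] at h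
    have h1 : (f ^ q).natDegree = 0 := by rw [h, Polynomial.natDegree_C]
    rw [Polynomial.natDegree_pow] at h1
    refine ⟨?_, by simp⟩
    rcases Nat.mul_eq_zero.1 h1 with h2 | h2 <;> lia
  have hcop : IsCoprime f g := by
    have : IsCoprime (f ^ q) (g ^ p) := by
      refine ⟨Polynomial.C k⁻¹, -Polynomial.C k⁻¹ * Polynomial.C l, ?_⟩
      calc _ = Polynomial.C k⁻¹ * (f ^ q - Polynomial.C l * g ^ p) := by ring
        _ = 1 := by rw [h, ← Polynomial.C_mul, inv_mul_cancel₀ hk, Polynomial.C_1]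
    exact (IsCoprime.pow_iff (by lia) (by lia)).1 this
  have hne : p ≠ q := by
    rintro rfl
    rw [Nat.coprime_self] at hpq
    lia
  -- The Mason–Stothers condition 1/p + 1/q + 1/r ≤ 1, applied with 1^r as third term and r = pq.
  -- Among p, q ≥ 2 it fails only for p = q = 2, which coprimality excludes.
  have hineq : p * (p * q) + p * q * q + q * p ≤ q * p * (p * q) := by
    have : p + q + 1 ≤ p * q := by
      rcases Nat.lt_or_gt_of_ne hne with h | h <;> nlinarith
    nlinarith [Nat.zero_le (p * q)]
  have := Polynomial.flt_catalan (p := q) (q := p) (r := p * q) (a := f) (b := g) (c := 1)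
    (u := 1) (v := -l) (w := -k) (by lia) (by lia) (by positivity) hineq
    (by exact_mod_cast (by lia : q ≠ 0)) (by exact_mod_cast (by lia : p ≠ 0))
    (by exact_mod_cast (by positivity : p * q ≠ 0)) hf hg one_ne_zero hcop one_ne_zero
    (neg_ne_zero.2 hl) (neg_ne_zero.2 hk) (by
      rw [one_pow, Polynomial.C_neg, Polynomial.C_neg, ← h, Polynomial.C_1]; ring)
  exact ⟨this.1, this.2.1⟩

/-! ### Nonconstant arcs along which the leading form of a coordinate is constant -/

section TopForm

variable {K : Type*} [Field K]

/-- The family is the translation v ↦ v + t conjugated by ψ. It fixes ψ(u) and sends ψ(v) to ψ(v) +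
t, so it is not trivial. -/
theorem exists_family (ψ : Aut2 K) :
    ∃ E : MvPolynomial (Fin 2) K →ₐ[K] MvPolynomial (Fin 3) K,
      (∀ f, specialize K (E f) = f) ∧ E ≠ incl K ∧ E (ψ (X 0)) = incl K (ψ (X 0)) := by
  let E₀ : MvPolynomial (Fin 2) K →ₐ[K] MvPolynomial (Fin 3) K :=
    aeval ![incl K (ψ (X 0)), incl K (ψ (X 1)) + X 0]
  have hE : ∀ f, (E₀.comp ψ.symm.toAlgHom) (ψ f) = E₀ f := fun f => by simp
  refine ⟨E₀.comp ψ.symm.toAlgHom, fun f => ?_, fun h => ?_, ?_⟩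
  · obtain ⟨f, rfl⟩ := ψ.surjective f
    rw [hE]
    have : (specialize K).comp E₀ = ψ.toAlgHom := by
      ext1 i
      fin_cases i
      · simp [E₀, specialize_incl]
      · have : specialize K (X 0) = 0 := by simp [specialize]
        simp [E₀, specialize_incl, this]
    exact DFunLike.congr_fun this f
  · have h1 := DFunLike.congr_fun h (ψ (X 1))
    rw [hE] at h1
    simp [E₀] at h1
  · rw [hE]
    simp [E₀]

/-- The inclusion `K[t,u,v] → L[t]` for an algebra `L` over `K[u,v]`. -/
noncomputable def toPoly (K L : Type*) [Field K] [Field L] [Algebra K L]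
    [Algebra (MvPolynomial (Fin 2) K) L] [IsScalarTower K (MvPolynomial (Fin 2) K) L] :
    MvPolynomial (Fin 3) K →ₐ[K] Polynomial L :=
  (Polynomial.mapAlgHom (IsScalarTower.toAlgHom K (MvPolynomial (Fin 2) K) L)).comp
    (finSuccEquiv K 2).toAlgHom

section ToPoly

variable {L : Type*} [Field L] [Algebra K L] [Algebra (MvPolynomial (Fin 2) K) L]
  [IsScalarTower K (MvPolynomial (Fin 2) K) L]

theorem toPoly_injective [IsFractionRing (MvPolynomial (Fin 2) K) L] :
    Function.Injective (toPoly K L) := fun _ _ h =>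
  (finSuccEquiv K 2).injective (Polynomial.map_injective _
    (IsFractionRing.injective (MvPolynomial (Fin 2) K) L) h)

theorem toPoly_incl (f : MvPolynomial (Fin 2) K) :
    toPoly K L (incl K f) = Polynomial.C (algebraMap _ L f) := by
  have : (toPoly K L).comp (incl K) = (Polynomial.CAlgHom (R := K)).comp
      (IsScalarTower.toAlgHom K (MvPolynomial (Fin 2) K) L) := by
    ext1 i
    simp [toPoly, finSuccEquiv_X_succ]
  exact DFunLike.congr_fun this f

theorem coeff_zero_toPoly (g : MvPolynomial (Fin 3) K) :
    (toPoly K L g).coeff 0 = algebraMap _ L (specialize K g) := by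
  have : Polynomial.constantCoeff.comp (toPoly K L).toRingHom =
      ((IsScalarTower.toAlgHom K (MvPolynomial (Fin 2) K) L).comp (specialize K)).toRingHom := by
    apply MvPolynomial.ringHom_ext
    · intro r
      have : (toPoly K L) (C r) = Polynomial.C (algebraMap K L r) := by
        rw [← algebraMap_eq, AlgHom.commutes]; rfl
      simp only [AlgHom.toRingHom_eq_coe, RingHom.coe_comp, RingHom.coe_coe, Function.comp_apply,
        this, Polynomial.constantCoeff_apply, Polynomial.coeff_C_zero]
      rw [← algebraMap_eq, AlgHom.commutes]
    · intro i
      refine Fin.cases ?_ (fun j => ?_) i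
      · simp [toPoly, specialize, finSuccEquiv_X_zero]
      · simp [toPoly, specialize, finSuccEquiv_X_succ]
  exact DFunLike.congr_fun this g

end ToPoly

/-- A polynomial family of points of the plane over the fraction field of `K[u,v]`, on which
the given form is constant. -/
theorem exists_arc (L : Type*) [Field L] [Algebra K L] [Algebra (MvPolynomial (Fin 2) K) L]
    [IsScalarTower K (MvPolynomial (Fin 2) K) L] [IsFractionRing (MvPolynomial (Fin 2) K) L]
    (ψ : Aut2 K) (w : Fin 2 → ℤ) {F' : MvPolynomial (Fin 2) K} {n : ℤ}
    (hF' : HasTop w n (ψ (X 0)) F') :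
    ∃ Θ : MvPolynomial (Fin 2) K →ₐ[K] Polynomial L,
      (∀ f, (Θ f).coeff 0 = algebraMap _ _ f) ∧ (Θ F').natDegree = 0 ∧
      ¬ ((Θ (X 0)).natDegree = 0 ∧ (Θ (X 1)).natDegree = 0) := by
  obtain ⟨E, hE0, hE, hEF⟩ := exists_family ψ
  obtain ⟨Λ, hΛ0, hΛ, hΛF⟩ := exists_limit E hE0 hE w hEF hF'
  refine ⟨(toPoly K L).comp Λ, fun f => ?_, ?_, fun h => hΛ ?_⟩
  · rw [AlgHom.comp_apply, coeff_zero_toPoly, hΛ0]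
  · rw [AlgHom.comp_apply, hΛF, toPoly_incl, Polynomial.natDegree_C]
  · ext1 i
    apply toPoly_injective (L := L)
    have hi : (toPoly K L (Λ (X i))).natDegree = 0 := by
      fin_cases i
      · exact h.1
      · exact h.2
    rw [toPoly_incl, Polynomial.eq_C_of_natDegree_eq_zero hi, coeff_zero_toPoly, hΛ0]

end TopForm

/-! ### Factoring the leading form of a coordinate -/

section BinaryForms

variable {K : Type*} [Field K]

/-- Coprimality makes the exponent of u a multiple of q, so F is a binary form of degree g in u^q
and v^p. -/
theorem eq_sum_of_isWeightedHomogeneous {p q g : ℕ} (hp : 0 < p) (hq : 0 < q)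
    (hpq : Nat.Coprime p q) {F : MvPolynomial (Fin 2) K}
    (hF : F.IsWeightedHomogeneous (![(p : ℤ), q]) ((p * q * g : ℕ) : ℤ)) :
    F = ∑ i ∈ Finset.range (g + 1),
      monomial (expo (q * i) (p * (g - i))) (coeff (expo (q * i) (p * (g - i))) F) := by
  classical
  rw [← Finset.sum_image (g := fun i => expo (q * i) (p * (g - i)))
    (f := fun d => monomial d (coeff d F))]
  · conv_lhs => rw [F.as_sum]
    refine Finset.sum_subset (fun d hd => ?_) fun d _ hd => ?_
    · have h := hF (mem_support_iff.1 hd)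
      rw [weight_fin_two] at h
      have h1 : d 0 * p + d 1 * q = p * q * g := by
        have : ((d 0 * p + d 1 * q : ℕ) : ℤ) = ((p * q * g : ℕ) : ℤ) := by
          rw [← h]; simp
        exact_mod_cast this
      have h2 : q ∣ d 0 := by
        refine hpq.symm.dvd_of_dvd_mul_right ((Nat.dvd_add_left (dvd_mul_left q (d 1))).1 ?_)
        rw [h1]
        exact ⟨p * g, by ring⟩
      obtain ⟨i, hi⟩ := h2
      have h3 : p * i + d 1 = p * g := by
        apply Nat.eq_of_mul_eq_mul_left hq
        rw [hi] at h1
        linarith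
      have h4 : i ≤ g := by
        by_contra h
        have : p * g < p * i := Nat.mul_lt_mul_of_pos_left (by lia) hp
        lia
      refine Finset.mem_image.2 ⟨i, Finset.mem_range.2 (by lia), ?_⟩
      rw [eq_expo d, hi, Nat.mul_sub]
      congr 1
      lia
    · rw [notMem_support_iff.1 hd, monomial_zero]
  · intro i _ j _ h
    have := DFunLike.congr_fun h 0
    simp only [expo_zero] at this
    exact Nat.eq_of_mul_eq_mul_left hq this

theorem homogenize_eq_prod_roots [IsAlgClosed K] (H : Polynomial K) {g : ℕ}
    (hg : H.natDegree = g) : H.homogenize g =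
      C H.leadingCoeff * (H.roots.map fun r => (X 0 - C r * X 1)).prod := by
  have hs := IsAlgClosed.splits H
  have hc : H.roots.card = g := by rw [← hg]; exact hs.natDegree_eq_card_roots.symm
  conv_lhs => rw [hs.eq_prod_roots]
  rw [Polynomial.homogenize_C_mul, ← homogenize_prod_roots, hc]

end BinaryForms

/-- The top form of a coordinate of the plane for weights adapted to its bidegree. -/
theorem exists_topForm {K : Type*} [Field K] [IsAlgClosed K] [CharZero K] (ψ : Aut2 K)
    (h0 : 0 < degreeOf 0 (ψ (X 0))) (h1 : 0 < degreeOf 1 (ψ (X 0))) :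
    ∃ p q g : ℕ, 0 < p ∧ 0 < q ∧ 0 < g ∧ degreeOf 0 (ψ (X 0)) = q * g ∧
      degreeOf 1 (ψ (X 0)) = p * g ∧ (p = 1 ∨ q = 1) ∧
      coeff (expo (q * g) 0) (ψ (X 0)) ≠ 0 ∧ coeff (expo (q * (g - 1)) p) (ψ (X 0)) ≠ 0 ∧
      ∃ l c : K, l ≠ 0 ∧ c ≠ 0 ∧
        HasTop ![(p : ℤ), q] ((p * q * g : ℕ) : ℤ) (ψ (X 0))
          (C c * (X 0 ^ q - C l * X 1 ^ p) ^ g) := by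
  obtain ⟨F, hF⟩ : ∃ F, F = ψ (X 0) := ⟨_, rfl⟩
  obtain ⟨M, hM⟩ : ∃ M, M = degreeOf 0 (ψ (X 0)) := ⟨_, rfl⟩
  obtain ⟨N, hN⟩ : ∃ N, N = degreeOf 1 (ψ (X 0)) := ⟨_, rfl⟩
  rw [← hM] at h0 ⊢
  rw [← hN] at h1 ⊢
  -- With M : N = q : p in lowest terms, the weights (p, q) give u^M and v^N the same weight pqg.
  obtain ⟨g, q, p, hg, hqp, hMq, hNp⟩ := Nat.exists_coprime' (m := M) (n := N)
    (Nat.gcd_pos_of_pos_left _ h0)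
  have hp : 0 < p := Nat.pos_of_ne_zero (by rintro rfl; lia)
  have hq : 0 < q := Nat.pos_of_ne_zero (by rintro rfl; lia)
  have hF0 : F ≠ 0 := by
    rw [hF]
    intro h
    rw [h, degreeOf_zero] at hM
    lia
  let w : Fin 2 → ℤ := ![(p : ℤ), q]
  have hw : ∀ d, Finsupp.weight w d = ((d 0 * p + d 1 * q : ℕ) : ℤ) := fun d => by
    rw [weight_fin_two]; simp [w]
  obtain ⟨d, hd, hmax⟩ := F.support.exists_max_image (fun d => Finsupp.weight w d)
    (Finset.nonempty_iff_ne_empty.2 (by simpa using hF0))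
  obtain ⟨n, hn⟩ : ∃ n, n = d 0 * p + d 1 * q := ⟨_, rfl⟩
  have hmax' : ∀ e, coeff e F ≠ 0 → e 0 * p + e 1 * q ≤ n := by
    intro e he
    have := hmax e (mem_support_iff.2 he)
    simp only [hw, ← hn] at this
    exact_mod_cast this
  have htop : HasTop w n F (weightedHomogeneousComponent w n F) := by
    refine .of_weightAtMost fun e he => ?_
    rw [hw]
    exact_mod_cast hmax' e he
  obtain ⟨F', hF'⟩ : ∃ F', F' = weightedHomogeneousComponent w n F := ⟨_, rfl⟩
  rw [← hF'] at htop
  have hF'0 : F' ≠ 0 := by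
    intro h
    rw [h] at htop
    have := htop.coeff_eq (d := d) (by rw [hw, hn])
    rw [coeff_zero] at this
    exact mem_support_iff.1 hd this
  have hcoeff : ∀ e, coeff e F' ≠ 0 → e 0 * p + e 1 * q = n ∧ coeff e F ≠ 0 := by
    intro e he
    have h2 := htop.homogeneous he
    rw [htop.coeff_eq h2]
    rw [hw] at h2
    exact ⟨by exact_mod_cast h2, he⟩
  rw [hF] at htop
  obtain ⟨Θ, hΘ0, hΘF, hΘ⟩ := exists_arc (FractionRing (MvPolynomial (Fin 2) K)) ψ w htop
  rw [← hF] at htop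
  have hΘinj : ∀ f, Θ f = 0 → f = 0 := fun f hf => by
    have := hΘ0 f
    rw [hf, Polynomial.coeff_zero] at this
    exact (map_eq_zero_iff _ (IsFractionRing.injective (MvPolynomial (Fin 2) K)
      (FractionRing (MvPolynomial (Fin 2) K)))).1 this.symm
  -- The image of F' is a nonzero constant in t, so its divisors have degree zero in t too.
  have hdvd : ∀ f, f ∣ F' → (Θ f).natDegree = 0 := fun f hf => by
    have := Polynomial.natDegree_le_of_dvd (map_dvd Θ hf) fun h => hF'0 (hΘinj _ h)
    lia
  obtain ⟨d₀, hd₀, hd₀M⟩ := exists_coeff_degreeOf hF0 0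
  obtain ⟨d₁, hd₁, hd₁N⟩ := exists_coeff_degreeOf hF0 1
  rw [hF, ← hM] at hd₀M
  rw [hF, ← hN] at hd₁N
  have hb₀ : ∀ e, coeff e F ≠ 0 → e 0 ≤ M := fun e he => by
    rw [hM, ← hF]; exact le_degreeOf he 0
  have hb₁ : ∀ e, coeff e F ≠ 0 → e 1 ≤ N := fun e he => by
    rw [hN, ← hF]; exact le_degreeOf he 1
  have hMN : M * p = N * q := by rw [hMq, hNp]; ring
  have hnM : M * p ≤ n := by have := hmax' d₀ hd₀; rw [hd₀M] at this; lia
  -- If u and v both divided F', both coordinates of the arc would be constant. So F' contains a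
  -- monomial free of one variable, and the degree bounds M and N then pin down the top weight.
  have hn' : n = M * p := by
    have hor : (∃ e, coeff e F' ≠ 0 ∧ e 0 = 0) ∨ ∃ e, coeff e F' ≠ 0 ∧ e 1 = 0 := by
      by_contra! h
      exact hΘ ⟨hdvd _ (X_dvd_of_forall h.1), hdvd _ (X_dvd_of_forall h.2)⟩
    rcases hor with ⟨e, he, he0⟩ | ⟨e, he, he0⟩
    · obtain ⟨h2, h3⟩ := hcoeff e he
      have := Nat.mul_le_mul_right q (hb₁ e h3)
      rw [he0] at h2
      lia
    · obtain ⟨h2, h3⟩ := hcoeff e he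
      have := Nat.mul_le_mul_right p (hb₀ e h3)
      rw [he0] at h2
      lia
  have hn2 : n = p * q * g := by rw [hn', hMq]; ring
  have hcM : coeff (expo (q * g) 0) F ≠ 0 := by
    have h2 := hmax' d₀ hd₀
    rw [hd₀M, hn'] at h2
    have h3 : d₀ 1 = 0 := by
      rcases Nat.mul_eq_zero.1 (show d₀ 1 * q = 0 by lia) with h | h <;> lia
    rw [eq_expo d₀, hd₀M, h3, hMq] at hd₀
    exact hd₀
  have hcN : coeff (expo 0 (p * g)) F ≠ 0 := by
    have h2 := hmax' d₁ hd₁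
    rw [hd₁N, hn', hMN] at h2
    have h3 : d₁ 0 = 0 := by
      rcases Nat.mul_eq_zero.1 (show d₁ 0 * p = 0 by lia) with h | h <;> lia
    rw [eq_expo d₁, hd₁N, h3, hNp] at hd₁
    exact hd₁
  have hFF' : ∀ i ≤ g, coeff (expo (q * i) (p * (g - i))) F' =
      coeff (expo (q * i) (p * (g - i))) F := by
    intro i hi
    refine (htop.coeff_eq ?_).symm
    rw [hw, hn2]
    obtain ⟨j, rfl⟩ := Nat.exists_eq_add_of_le hi
    simp only [expo_zero, expo_one, Nat.add_sub_cancel_left]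
    congr 1
    ring
  -- H is the dehomogenization of F' as a form in u^q and v^p; its roots give the factors u^q - r
  -- v^p.
  let H : Polynomial K := ∑ i ∈ Finset.range (g + 1),
    Polynomial.monomial i (coeff (expo (q * i) (p * (g - i))) F')
  have hH : ∀ i ≤ g, H.coeff i = coeff (expo (q * i) (p * (g - i))) F := by
    intro i hi
    simp only [H, Polynomial.finsetSum_coeff, Polynomial.coeff_monomial]
    rw [Finset.sum_ite_eq', if_pos (Finset.mem_range.2 (by lia)), hFF' i hi]
  have hHg : H.coeff g ≠ 0 := by rw [hH g le_rfl]; simpa using hcM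
  have hH0 : H.coeff 0 ≠ 0 := by rw [hH 0 (by lia)]; simpa using hcN
  have hHdeg : H.natDegree = g := by
    refine le_antisymm (Polynomial.natDegree_sum_le_of_forall_le _ _ fun i hi => ?_)
      (Polynomial.le_natDegree_of_ne_zero hHg)
    exact (Polynomial.natDegree_monomial_le _).trans (Nat.lt_succ_iff.1 (Finset.mem_range.1 hi))
  have hFH : F' = aeval ![(X 0 ^ q : MvPolynomial (Fin 2) K), X 1 ^ p] (H.homogenize g) := by
    have h2 := htop.homogeneous
    rw [hn2] at h2
    conv_lhs => rw [eq_sum_of_isWeightedHomogeneous hp hq hqp.symm h2]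
    simp only [H, Polynomial.homogenize_finsetSum, map_sum]
    refine Finset.sum_congr rfl fun i hi => ?_
    have hi' : i ≤ g := Nat.lt_succ_iff.1 (Finset.mem_range.1 hi)
    rw [Polynomial.homogenize_monomial hi', monomial_expo, aeval_monomial,
      Finsupp.prod_fintype _ _ (by simp), Fin.prod_univ_two]
    simp [pow_mul, mul_assoc]
  rw [homogenize_eq_prod_roots H hHdeg] at hFH
  have hFprod : F' = C H.leadingCoeff *
      (H.roots.map fun r => (X 0 ^ q - C r * X 1 ^ p : MvPolynomial (Fin 2) K)).prod := by
    rw [hFH, map_mul, map_multiset_prod, Multiset.map_map]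
    simp
  have hroot : ∀ r ∈ H.roots,
      (Θ (X 0) ^ q - Polynomial.C (algebraMap K _ r) * Θ (X 1) ^ p).natDegree = 0 := by
    intro r hr
    have h2 := hdvd (X 0 ^ q - C r * X 1 ^ p) (by
      rw [hFprod]
      exact (Multiset.dvd_prod (Multiset.mem_map_of_mem _ hr)).mul_left _)
    rwa [map_sub, map_mul, map_pow, map_pow, ← algebraMap_eq, AlgHom.commutes] at h2
  have hroot0 : ∀ r ∈ H.roots, r ≠ 0 := by
    rintro r hr rfl
    have := Polynomial.isRoot_of_mem_roots hr
    rw [Polynomial.IsRoot, ← Polynomial.coeff_zero_eq_eval_zero] at this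
    exact hH0 this
  have hcard : H.roots.card = g := by
    rw [← hHdeg]; exact (IsAlgClosed.splits H).natDegree_eq_card_roots.symm
  obtain ⟨l, hl⟩ := Multiset.card_pos_iff_exists_mem.1 (hcard.symm ▸ hg)
  have hpq1 : p = 1 ∨ q = 1 := by
    by_contra! h
    apply hΘ
    have h2 := Polynomial.eq_C_of_natDegree_eq_zero (hroot l hl)
    refine natDegree_eq_zero_of_binomial (p := p) (q := q) (by lia) (by lia) hqp.symm ?_ ?_ h2
    · rw [Ne, map_eq_zero]
      exact hroot0 l hl
    -- The constant is nonzero: Θ is injective, and u^q - l v^p takes the value 1 at (1, 0).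
    · intro h3
      rw [h3, Polynomial.C_0] at h2
      have h4 := hΘinj (X 0 ^ q - C l * X 1 ^ p) (by
        rw [map_sub, map_mul, map_pow, map_pow, ← algebraMap_eq, AlgHom.commutes]; exact h2)
      have h5 := congrArg (aeval ![(1 : K), 0]) h4
      simp [zero_pow hp.ne'] at h5
  -- With two distinct roots, u^q and v^p are linear combinations of two quantities constant along
  -- the arc, so both coordinates are constant.
  have hall : ∀ r ∈ H.roots, r = l := by
    intro r hr
    by_contra hne
    apply hΘ
    have h2 := Polynomial.eq_C_of_natDegree_eq_zero (hroot l hl)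
    have h3 := Polynomial.eq_C_of_natDegree_eq_zero (hroot r hr)
    generalize (Θ (X 0) ^ q - Polynomial.C (algebraMap K _ l) * Θ (X 1) ^ p).coeff 0 = s at h2
    generalize (Θ (X 0) ^ q - Polynomial.C (algebraMap K _ r) * Θ (X 1) ^ p).coeff 0 = t at h3
    generalize hl' : algebraMap K (FractionRing (MvPolynomial (Fin 2) K)) l = l' at h2
    generalize hr' : algebraMap K (FractionRing (MvPolynomial (Fin 2) K)) r = r' at h3
    have hne' : r' - l' ≠ 0 := by
      rw [← hl', ← hr', ← map_sub, Ne, map_eq_zero]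
      exact sub_ne_zero.2 hne
    have h4 : Θ (X 1) ^ p = Polynomial.C ((r' - l')⁻¹ * (s - t)) := by
      rw [Polynomial.C_mul, Polynomial.C_sub, ← h2, ← h3]
      have : Polynomial.C (r' - l')⁻¹ * Polynomial.C (r' - l') = 1 := by
        rw [← Polynomial.C_mul, inv_mul_cancel₀ hne', Polynomial.C_1]
      rw [map_sub Polynomial.C] at this
      linear_combination (-Θ (X 1) ^ p) * this
    have h5 : Θ (X 0) ^ q = Polynomial.C (s + l' * ((r' - l')⁻¹ * (s - t))) := by
      rw [Polynomial.C_add, Polynomial.C_mul, ← h4, ← h2]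
      ring
    have h6 := congrArg Polynomial.natDegree h4
    have h7 := congrArg Polynomial.natDegree h5
    rw [Polynomial.natDegree_pow, Polynomial.natDegree_C] at h6 h7
    constructor
    · rcases Nat.mul_eq_zero.1 h7 with h | h <;> lia
    · rcases Nat.mul_eq_zero.1 h6 with h | h <;> lia
  have hrep : H.roots = Multiset.replicate g l := Multiset.eq_replicate.2 ⟨hcard, hall⟩
  have hlc : H.leadingCoeff ≠ 0 := by rwa [Polynomial.leadingCoeff, hHdeg]
  have hHpow : H = Polynomial.C H.leadingCoeff * (Polynomial.X - Polynomial.C l) ^ g := by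
    conv_lhs => rw [(IsAlgClosed.splits H).eq_prod_roots, hrep]
    rw [Multiset.map_replicate, Multiset.prod_replicate]
  refine ⟨p, q, g, hp, hq, hg, hMq, hNp, hpq1, hF ▸ hcM, ?_, l, H.leadingCoeff, hroot0 l hl, hlc,
    ?_⟩
  -- This coefficient is -g l times the leading one, nonzero in characteristic zero.
  · have h2 := hH (g - 1) (by lia)
    rw [show g - (g - 1) = 1 by lia, mul_one] at h2
    rw [← hF, ← h2, hHpow, Polynomial.coeff_C_mul, sub_eq_add_neg, ← Polynomial.C_neg, Polynomial.coeff_X_add_C_pow,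
      show g - (g - 1) = 1 by lia, pow_one]
    refine mul_ne_zero hlc (mul_ne_zero (neg_ne_zero.2 (hroot0 l hl)) ?_)
    exact_mod_cast (Nat.choose_pos (Nat.sub_le g 1)).ne'
  · rw [← hF, ← hn2]
    rw [hrep, Multiset.map_replicate, Multiset.prod_replicate] at hFprod
    rw [← hFprod]
    exact htop

/-! ### Elementary automorphisms of the plane -/

section Automorphisms

variable {K : Type*} [Field K]

theorem aut2_ext {φ ψ : Aut2 K} (h0 : φ (X 0) = ψ (X 0)) (h1 : φ (X 1) = ψ (X 1)) : φ = ψ := by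
  have : φ.toAlgHom = ψ.toAlgHom := by
    ext1 i
    fin_cases i
    · exact h0
    · exact h1
  exact AlgEquiv.coe_toAlgHom_injective this

/-- A degree-preserving automorphism commutes with the projections to the components, hence so does
its inverse. -/
theorem symm_isWeightedHomogeneous {σ M : Type*} [AddCommMonoid M] {w : σ → M}
    {φ : MvPolynomial σ K ≃ₐ[K] MvPolynomial σ K}
    (h : ∀ n p, p.IsWeightedHomogeneous w n → (φ p).IsWeightedHomogeneous w n) (n : M)
    (p : MvPolynomial σ K) (hp : p.IsWeightedHomogeneous w n) :
    (φ.symm p).IsWeightedHomogeneous w n := by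
  classical
  have key : ∀ q : MvPolynomial σ K,
      weightedHomogeneousComponent w n (φ q) = φ (weightedHomogeneousComponent w n q) := by
    intro q
    have hq := sum_weightedHomogeneousComponent w q
    have hfin := weightedHomogeneousComponent_finsupp (w := w) q
    rw [finsum_eq_sum _ hfin] at hq
    conv_lhs => rw [← hq]
    rw [map_sum, map_sum]
    have hterm : ∀ m ∈ hfin.toFinset,
        weightedHomogeneousComponent w n (φ (weightedHomogeneousComponent w m q))
          = if m = n then φ (weightedHomogeneousComponent w n q) else 0 := by
      intro m _
      have hm := h m _ (weightedHomogeneousComponent_isWeightedHomogeneous (w := w) m q)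
      split_ifs with hmn
      · subst hmn
        exact hm.weightedHomogeneousComponent_same
      · exact hm.weightedHomogeneousComponent_ne n (Ne.symm hmn)
    rw [Finset.sum_congr rfl hterm, Finset.sum_ite_eq']
    split_ifs with hn
    · rfl
    · have : weightedHomogeneousComponent w n q = 0 := by
        by_contra hne
        exact hn (hfin.mem_toFinset.2 hne)
      rw [this, map_zero]
  have h1 := key (φ.symm p)
  rw [AlgEquiv.apply_symm_apply, hp.weightedHomogeneousComponent_same] at h1
  rw [h1, AlgEquiv.symm_apply_apply]
  exact weightedHomogeneousComponent_isWeightedHomogeneous (w := w) n _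

/-- An automorphism fixing all variables but one is elementary. -/
theorem exists_eq_C_mul_X_add {n : ℕ}
    (φ : MvPolynomial (Fin (n + 1)) K ≃ₐ[K] MvPolynomial (Fin (n + 1)) K)
    (hφ : ∀ j : Fin n, φ (X j.succ) = X j.succ) :
    ∃ (l : K) (F : MvPolynomial (Fin n) K), l ≠ 0 ∧ φ (X 0) = C l * X 0 + rename Fin.succ F := by
  let e := finSuccEquiv K n
  let h : Polynomial (MvPolynomial (Fin n) K) ≃ₐ[K] Polynomial (MvPolynomial (Fin n) K) :=
    (e.symm.trans φ).trans e
  obtain ⟨q, hq⟩ : ∃ q, q = h Polynomial.X := ⟨_, rfl⟩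
  have hC : ∀ r, h (Polynomial.C r) = Polynomial.C r := by
    intro r
    have : (h.toAlgHom.comp (Polynomial.CAlgHom (R := K) (A := MvPolynomial (Fin n) K))) =
        Polynomial.CAlgHom := by
      ext1 i
      have h1 : e.symm (Polynomial.C (X i)) = X i.succ := by
        rw [AlgEquiv.symm_apply_eq]
        exact finSuccEquiv_X_succ.symm
      simp [h, h1, hφ]
      exact finSuccEquiv_X_succ
    exact DFunLike.congr_fun this r
  have hcomp : ∀ p, h p = p.comp q := by
    intro p
    have : h.toAlgHom.toRingHom = Polynomial.compRingHom q := by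
      apply Polynomial.ringHom_ext
      · intro r
        simp [hC]
      · simp [hq]
    exact DFunLike.congr_fun this p
  -- Over the ring of the fixed variables, φ is the substitution T ↦ q. Surjectivity inverts it
  -- under composition, so q has degree one and a unit as leading coefficient.
  obtain ⟨p, hp⟩ : ∃ p, p.comp q = Polynomial.X :=
    ⟨h.symm Polynomial.X, by rw [← hcomp, AlgEquiv.apply_symm_apply]⟩
  have hdeg : p.natDegree * q.natDegree = 1 := by
    rw [← Polynomial.natDegree_comp, hp, Polynomial.natDegree_X]
  have hq1 : q.natDegree = 1 := Nat.eq_one_of_mul_eq_one_left hdeg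
  have hp1 : p.natDegree = 1 := Nat.eq_one_of_mul_eq_one_right hdeg
  have hlc := Polynomial.leadingCoeff_comp (p := p) (q := q) (by lia)
  rw [hp, Polynomial.leadingCoeff_X, hp1, pow_one] at hlc
  have hu : IsUnit q.leadingCoeff := .of_mul_eq_one_right _ hlc.symm
  obtain ⟨l, hl, hql⟩ := isUnit_iff_eq_C_of_isReduced.1 hu
  rw [Polynomial.leadingCoeff, hq1] at hql
  refine ⟨l, q.coeff 0, hl.ne_zero, e.injective ?_⟩
  have h2 : e (φ (X 0)) = q := by
    have : e.symm Polynomial.X = X 0 := by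
      rw [AlgEquiv.symm_apply_eq]
      exact finSuccEquiv_X_zero.symm
    simp [hq, h, this]
  have h3 : ∀ F, e (rename Fin.succ F) = Polynomial.C F := by
    intro F
    have : e.toAlgHom.comp (rename Fin.succ) =
        Polynomial.CAlgHom (R := K) (A := MvPolynomial (Fin n) K) := by
      ext1 i
      simp [e, finSuccEquiv_X_succ]
    exact DFunLike.congr_fun this F
  rw [h2, Polynomial.eq_X_add_C_of_natDegree_le_one hq1.le, hql, map_add, map_mul, h3]
  have h4 : e (C l) = Polynomial.C (C l) := by simp [e, finSuccEquiv_apply]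
  rw [h4, show e (X 0) = Polynomial.X from finSuccEquiv_X_zero]
  simp

/-- The polynomial `g(u)` in `K[u,v]`. -/
noncomputable def atU (g : Polynomial K) : MvPolynomial (Fin 2) K :=
  Polynomial.aeval (X 0) g

theorem atV_add (f g : Polynomial K) : atV (f + g) = atV f + atV g := map_add _ _ _

theorem atU_add (f g : Polynomial K) : atU (f + g) = atU f + atU g := map_add _ _ _

theorem atV_monomial (q : ℕ) (r : K) : atV (Polynomial.monomial q r) = monomial (expo 0 q) r := by
  rw [atV, Polynomial.aeval_monomial, monomial_expo, pow_zero, mul_one, algebraMap_eq]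

theorem atU_monomial (q : ℕ) (r : K) : atU (Polynomial.monomial q r) = monomial (expo q 0) r := by
  rw [atU, Polynomial.aeval_monomial, monomial_expo, pow_zero, mul_one, algebraMap_eq]

theorem coeff_atV (f : Polynomial K) (d : Fin 2 →₀ ℕ) :
    coeff d (atV f) = if d 0 = 0 then f.coeff (d 1) else 0 := by
  classical
  induction f using Polynomial.induction_on' with
  | add f g hf hg => rw [atV_add, coeff_add, hf, hg]; split_ifs <;> simp
  | monomial q r =>
    rw [atV_monomial, coeff_monomial, Polynomial.coeff_monomial]
    by_cases h : expo 0 q = d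
    · subst h; simp
    · rw [if_neg h]
      split_ifs with h1 h2
      · exact absurd (by rw [eq_expo d, h1, h2]) h
      · rfl
      · rfl

theorem coeff_atU (f : Polynomial K) (d : Fin 2 →₀ ℕ) :
    coeff d (atU f) = if d 1 = 0 then f.coeff (d 0) else 0 := by
  classical
  induction f using Polynomial.induction_on' with
  | add f g hf hg => rw [atU_add, coeff_add, hf, hg]; split_ifs <;> simp
  | monomial q r =>
    rw [atU_monomial, coeff_monomial, Polynomial.coeff_monomial]
    by_cases h : expo q 0 = d
    · subst h; simp
    · rw [if_neg h]
      split_ifs with h1 h2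
      · exact absurd (by rw [eq_expo d, h1, h2]) h
      · rfl
      · rfl

/-- The automorphism `(l u + f(v), v)`. -/
noncomputable def elemU (l : Kˣ) (f : Polynomial K) : Aut2 K :=
  AlgEquiv.ofAlgHom (aeval ![C (l : K) * X 0 + atV f, X 1])
    (aeval ![C ((l⁻¹ : Kˣ) : K) * (X 0 - atV f), X 1])
    (by
      have h : C (l : K) * C ((l⁻¹ : Kˣ) : K) = (1 : MvPolynomial (Fin 2) K) := by
        rw [← C_mul, Units.mul_inv, C_1]
      ext1 i
      fin_cases i
      · simp only [Fin.zero_eta, AlgHom.comp_apply, aeval_X, Matrix.cons_val_zero, map_mul,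
          map_sub, algHom_C, algebraMap_eq, atV, ← Polynomial.aeval_algHom_apply,
          Matrix.cons_val_one, AlgHom.id_apply]
        linear_combination (X 0) * h
      · simp)
    (by
      have h : C (l : K) * C ((l⁻¹ : Kˣ) : K) = (1 : MvPolynomial (Fin 2) K) := by
        rw [← C_mul, Units.mul_inv, C_1]
      ext1 i
      fin_cases i
      · simp only [Fin.zero_eta, AlgHom.comp_apply, aeval_X, Matrix.cons_val_zero, map_mul,
          map_add, algHom_C, algebraMap_eq, atV, ← Polynomial.aeval_algHom_apply,
          Matrix.cons_val_one, AlgHom.id_apply]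
        linear_combination (X 0 - Polynomial.aeval (X 1) f) * h
      · simp)

/-- The automorphism `(u, l v + g(u))`. -/
noncomputable def elemV (l : Kˣ) (g : Polynomial K) : Aut2 K :=
  AlgEquiv.ofAlgHom (aeval ![X 0, C (l : K) * X 1 + atU g])
    (aeval ![X 0, C ((l⁻¹ : Kˣ) : K) * (X 1 - atU g)])
    (by
      have h : C (l : K) * C ((l⁻¹ : Kˣ) : K) = (1 : MvPolynomial (Fin 2) K) := by
        rw [← C_mul, Units.mul_inv, C_1]
      ext1 i
      fin_cases i
      · simp
      · simp only [Fin.mk_one, AlgHom.comp_apply, aeval_X, Matrix.cons_val_zero, map_mul,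
          map_sub, algHom_C, algebraMap_eq, atU, ← Polynomial.aeval_algHom_apply,
          Matrix.cons_val_one, AlgHom.id_apply]
        linear_combination (X 1) * h)
    (by
      have h : C (l : K) * C ((l⁻¹ : Kˣ) : K) = (1 : MvPolynomial (Fin 2) K) := by
        rw [← C_mul, Units.mul_inv, C_1]
      ext1 i
      fin_cases i
      · simp
      · simp only [Fin.mk_one, AlgHom.comp_apply, aeval_X, Matrix.cons_val_zero, map_mul,
          map_add, algHom_C, algebraMap_eq, atU, ← Polynomial.aeval_algHom_apply,
          Matrix.cons_val_one, AlgHom.id_apply]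
        linear_combination (X 1 - Polynomial.aeval (X 0) g) * h)

@[simp] theorem elemU_X_zero (l : Kˣ) (f : Polynomial K) :
    elemU l f (X 0) = C (l : K) * X 0 + atV f := by
  simp [elemU]

@[simp] theorem elemU_X_one (l : Kˣ) (f : Polynomial K) : elemU l f (X 1) = X 1 := by
  simp [elemU]

@[simp] theorem elemV_X_zero (l : Kˣ) (g : Polynomial K) : elemV l g (X 0) = X 0 := by
  simp [elemV]

@[simp] theorem elemV_X_one (l : Kˣ) (g : Polynomial K) :
    elemV l g (X 1) = C (l : K) * X 1 + atU g := by
  simp [elemV]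

theorem map_C {σ τ : Type*} (φ : MvPolynomial σ K ≃ₐ[K] MvPolynomial τ K) (r : K) :
    φ (C r) = C r := by
  rw [← algebraMap_eq, AlgEquiv.commutes, algebraMap_eq]

theorem elemU_atV (l : Kˣ) (f g : Polynomial K) : elemU l f (atV g) = atV g := by
  rw [atV, ← Polynomial.aeval_algHom_apply, elemU_X_one]

theorem elemV_atU (l : Kˣ) (f g : Polynomial K) : elemV l f (atU g) = atU g := by
  rw [atU, ← Polynomial.aeval_algHom_apply, elemV_X_zero]

theorem elemU_mul (l m : Kˣ) (f g : Polynomial K) :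
    elemU l f * elemU m g = elemU (l * m) (Polynomial.C (m : K) * f + g) := by
  refine aut2_ext ?_ ?_
  · rw [AlgEquiv.mul_apply, elemU_X_zero, map_add, map_mul, map_C, elemU_X_zero, elemU_X_zero,
      elemU_atV, atV_add]
    simp only [atV, map_mul, Polynomial.aeval_C, algebraMap_eq, Units.val_mul]
    ring
  · simp [AlgEquiv.mul_apply]

theorem elemV_mul (l m : Kˣ) (f g : Polynomial K) :
    elemV l f * elemV m g = elemV (l * m) (Polynomial.C (m : K) * f + g) := by
  refine aut2_ext ?_ ?_
  · simp [AlgEquiv.mul_apply]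
  · rw [AlgEquiv.mul_apply, elemV_X_one, map_add, map_mul, map_C, elemV_X_one, elemV_X_one,
      elemV_atU, atU_add]
    simp only [atU, map_mul, Polynomial.aeval_C, algebraMap_eq, Units.val_mul]
    ring

theorem elemU_one_zero : elemU (1 : Kˣ) 0 = 1 := by
  refine aut2_ext ?_ ?_ <;> simp [atV]

theorem elemV_one_zero : elemV (1 : Kˣ) 0 = 1 := by
  refine aut2_ext ?_ ?_ <;> simp [atU]

theorem elemU_inv (l : Kˣ) (f : Polynomial K) :
    (elemU l f)⁻¹ = elemU l⁻¹ (-(Polynomial.C ((l⁻¹ : Kˣ) : K) * f)) := by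
  rw [inv_eq_iff_mul_eq_one, elemU_mul, mul_inv_cancel, add_neg_cancel, elemU_one_zero]

theorem elemV_inv (l : Kˣ) (f : Polynomial K) :
    (elemV l f)⁻¹ = elemV l⁻¹ (-(Polynomial.C ((l⁻¹ : Kˣ) : K) * f)) := by
  rw [inv_eq_iff_mul_eq_one, elemV_mul, mul_inv_cancel, add_neg_cancel, elemV_one_zero]

theorem exists_eq_elemV {ψ : Aut2 K} (h : ψ (X 0) = X 0) : ∃ l g, ψ = elemV l g := by
  let s : MvPolynomial (Fin 2) K ≃ₐ[K] MvPolynomial (Fin 2) K := renameEquiv K (Equiv.swap 0 1)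
  have hs0 : s (X 0) = X 1 := by simp [s]
  have hs1 : s (X 1) = X 0 := by simp [s]
  have hss : ∀ f, s (s f) = f := fun f => by simp [s, rename_rename, ← Equiv.coe_trans]
  obtain ⟨l, F, hl, hF⟩ := exists_eq_C_mul_X_add (n := 1) ((s.trans ψ).trans s) (by
    intro j
    fin_cases j
    change s (ψ (s (X 1))) = X 1
    rw [hs1, h, hs0])
  change s (ψ (s (X 0))) = _ at hF
  rw [hs0] at hF
  have h1 := congrArg s hF
  rw [hss, map_add, map_mul, map_C, hs0] at h1
  refine ⟨Units.mk0 l hl, aeval ![Polynomial.X] F, aut2_ext ?_ ?_⟩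
  · rw [h, elemV_X_zero]
  · rw [h1, elemV_X_one, Units.val_mk0]
    congr 1
    have : (s.toAlgHom.comp (rename Fin.succ) : MvPolynomial (Fin 1) K →ₐ[K] _) =
        (Polynomial.aeval (X 0)).comp (aeval ![Polynomial.X]) := by
      ext1 i
      fin_cases i
      simp
      exact hs1
    exact DFunLike.congr_fun this F

/-- The image of a variable is irreducible, and an irreducible polynomial in one variable over an
algebraically closed field is linear. -/
theorem exists_eq_C_mul_X [IsAlgClosed K] {ψ : Aut2 K} {i : Fin 2} {f : Polynomial K}
    (h : ψ (X 0) = Polynomial.aeval (X i) f) (h0 : constantCoeff (ψ (X 0)) = 0) :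
    ∃ r : K, r ≠ 0 ∧ ψ (X 0) = C r * X i := by
  have hirr : Irreducible (ψ (X 0)) := by
    rw [MulEquiv.irreducible_iff ψ]
    exact (X_prime (i := (0 : Fin 2))).irreducible
  rw [h] at hirr
  have hinv : ∀ g : Polynomial K,
      aeval (fun _ : Fin 2 => (Polynomial.X : Polynomial K))
        (Polynomial.aeval (X i : MvPolynomial (Fin 2) K) g) = g := by
    intro g
    rw [← Polynomial.aeval_algHom_apply, aeval_X, Polynomial.aeval_X_left_apply]
  have : IsLocalHom (Polynomial.aeval (X i : MvPolynomial (Fin 2) K) : Polynomial K →ₐ[K] _) := by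
    refine ⟨fun g hg => ?_⟩
    have := hg.map (aeval (fun _ : Fin 2 => (Polynomial.X : Polynomial K)))
    rwa [hinv] at this
  have hfirr : Irreducible f := hirr.of_map
  have hdeg := IsAlgClosed.degree_eq_one_of_irreducible K hfirr
  rw [Polynomial.eq_X_add_C_of_degree_le_one hdeg.le] at h
  simp only [map_add, map_mul, Polynomial.aeval_C, Polynomial.aeval_X, algebraMap_eq] at h
  have h1 : f.coeff 0 = 0 := by simpa [h] using h0
  rw [h1, C_0, add_zero] at h
  refine ⟨f.coeff 1, fun h2 => ?_, h⟩
  rw [h2, C_0, zero_mul] at h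
  exact X_ne_zero 0 ((map_eq_zero_iff ψ ψ.injective).1 h)

theorem eq_aeval_of_degreeOf_eq_zero {i j : Fin 2} (hij : i ≠ j) {f : MvPolynomial (Fin 2) K}
    (h : degreeOf j f = 0) : 
    f = Polynomial.aeval (X i) (aeval (fun _ => (Polynomial.X : Polynomial K)) f) := by
  classical
  have : ∀ k, k ∈ f.vars → k = i := by
    intro k hk
    have : k ≠ j := by
      rintro rfl
      obtain ⟨d, hd, hkd⟩ := (mem_vars_iff_mem_support k).1 hk
      have := le_degreeOf (mem_support_iff.1 hd) k
      rw [Finsupp.mem_support_iff] at hkd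
      lia
    lia
  have h1 : (AlgHom.id K (MvPolynomial (Fin 2) K)).toRingHom f =
      ((Polynomial.aeval (X i : MvPolynomial (Fin 2) K)).comp
        (aeval (fun _ : Fin 2 => (Polynomial.X : Polynomial K)))).toRingHom f := by
    refine hom_congr_vars ?_ ?_ rfl
    · ext r
      simp [← algebraMap_eq]
    · intro k hk _
      rw [this k hk]
      simp
  exact h1

end Automorphisms

/-! ### Plane automorphisms preserving the grading and the flag at the origin -/

section OriginGroup

variable {K : Type*} [Field K] {a b c : ℕ}

theorem homogeneous_atV_iff {f : Polynomial K} {n : ZMod c} :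
    (atV f).IsWeightedHomogeneous (deg2 a b c) n ↔ ∀ q, f.coeff q ≠ 0 → (q : ZMod c) * b = n := by
  constructor
  · intro h q hq
    have := @h (expo 0 q) (by rw [coeff_atV]; simpa using hq)
    simpa [weight_fin_two, deg2] using this
  · intro h d hd
    rw [coeff_atV] at hd
    split_ifs at hd with h0
    · simpa [weight_fin_two, deg2, h0] using h _ hd
    · exact absurd rfl hd

theorem homogeneous_atU_iff {f : Polynomial K} {n : ZMod c} :
    (atU f).IsWeightedHomogeneous (deg2 a b c) n ↔ ∀ q, f.coeff q ≠ 0 → (q : ZMod c) * a = n := by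
  constructor
  · intro h q hq
    have := @h (expo q 0) (by rw [coeff_atU]; simpa using hq)
    simpa [weight_fin_two, deg2] using this
  · intro h d hd
    rw [coeff_atU] at hd
    split_ifs at hd with h0
    · simpa [weight_fin_two, deg2, h0] using h _ hd
    · exact absurd rfl hd

theorem coeff_expo_zero_zero (f : MvPolynomial (Fin 2) K) :
    coeff (expo 0 0) f = constantCoeff f := by
  rw [constantCoeff_eq]
  congr 1
  ext i
  fin_cases i <;> simp

/-- Restriction to the axis `u = 0`. -/
noncomputable def axisV (K : Type*) [Field K] : MvPolynomial (Fin 2) K →ₐ[K] Polynomial K :=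
  aeval ![0, Polynomial.X]

theorem coeff_axisV (f : MvPolynomial (Fin 2) K) (j : ℕ) :
    (axisV K f).coeff j = coeff (expo 0 j) f := by
  induction f using MvPolynomial.induction_on' with
  | monomial d r =>
    rw [eq_expo d, monomial_expo]
    simp only [axisV, map_mul, map_pow, aeval_X, Matrix.cons_val_zero, Matrix.cons_val_one,
      algHom_C, Polynomial.algebraMap_eq]
    rw [← monomial_expo, coeff_monomial]
    by_cases h0 : d 0 = 0
    · rw [h0, pow_zero, mul_one, Polynomial.coeff_C_mul_X_pow]
      congr 1
      refine propext ⟨fun h => by rw [h], fun h => ?_⟩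
      simpa using (DFunLike.congr_fun h 1).symm
    · rw [zero_pow h0, mul_zero, zero_mul, Polynomial.coeff_zero, if_neg]
      intro h
      exact h0 (by simpa using DFunLike.congr_fun h 0)
  | add f g hf hg => rw [coeff_add, ← hf, ← hg, map_add, Polynomial.coeff_add]

theorem coeff_expo_zero_one_mul (f g : MvPolynomial (Fin 2) K) :
    coeff (expo 0 1) (f * g) =
      coeff (expo 0 1) f * constantCoeff g + constantCoeff f * coeff (expo 0 1) g := by
  simp only [← coeff_expo_zero_zero, ← coeff_axisV, map_mul, Polynomial.mul_coeff_one]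
  ring

/-- On the axis u = 0 the polynomial G is divisible by v, so G^n starts with the n-th power of its
linear term. -/
theorem coeff_expo_zero_pow {G : MvPolynomial (Fin 2) K} (hG : constantCoeff G = 0) {j n : ℕ}
    (hj : j ≤ n) :
    coeff (expo 0 j) (G ^ n) = if j = n then coeff (expo 0 1) G ^ n else 0 := by
  rw [← coeff_expo_zero_zero, ← coeff_axisV] at hG
  obtain ⟨r, hr⟩ := Polynomial.X_dvd_iff.2 hG
  rw [← coeff_axisV, ← coeff_axisV, map_pow, hr, mul_pow, Polynomial.coeff_X_pow_mul',
    Polynomial.coeff_X_mul]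
  by_cases h : j = n
  · rw [if_pos h.ge, if_pos h, h, Nat.sub_self, Polynomial.coeff_zero_eq_eval_zero,
      Polynomial.eval_pow, Polynomial.coeff_zero_eq_eval_zero]
  · rw [if_neg (by lia), if_neg h]

/-- The automorphisms of `K[u,v]` that preserve the grading by `ℤ/c` and the origin and, when
`b < a`, the tangent line `u = 0` at the origin. -/
def originGroup (K : Type*) [Field K] (a b c : ℕ) : Subgroup (Aut2 K) where
  carrier := {ψ | (∀ n p, p.IsWeightedHomogeneous (deg2 a b c) n →
      (ψ p).IsWeightedHomogeneous (deg2 a b c) n) ∧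
    (∀ p, constantCoeff (ψ p) = constantCoeff p) ∧
    (b < a → ∃ m : K, ∀ p, coeff (expo 0 1) (ψ p) = coeff (expo 0 1) p * m)}
  one_mem' := ⟨fun _ _ h => h, fun _ => rfl, fun _ => ⟨1, fun p => (mul_one _).symm⟩⟩
  mul_mem' := by
    rintro φ ψ ⟨h1, h2, h3⟩ ⟨h1', h2', h3'⟩
    refine ⟨fun n p hp => h1 n _ (h1' n p hp), fun p => (h2 _).trans (h2' p), fun h => ?_⟩
    obtain ⟨m, hm⟩ := h3 h
    obtain ⟨m', hm'⟩ := h3' h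
    exact ⟨m' * m, fun p => by rw [AlgEquiv.mul_apply, hm, hm', mul_assoc]⟩
  inv_mem' := by
    rintro φ ⟨h1, h2, h3⟩
    have hs : ∀ p, φ (φ⁻¹ p) = p := fun p => φ.apply_symm_apply p
    refine ⟨fun n p hp => symm_isWeightedHomogeneous h1 n p hp, fun p => ?_, fun h => ?_⟩
    · rw [← h2, hs]
    · obtain ⟨m, hm⟩ := h3 h
      have hm0 : m ≠ 0 := by
        rintro rfl
        have := hm (φ⁻¹ (X 1))
        rw [hs, mul_zero, coeff_X, if_pos] at this
        · exact one_ne_zero this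
        · simp [expo]
      refine ⟨m⁻¹, fun p => ?_⟩
      have := hm (φ⁻¹ p)
      rw [hs] at this
      rw [this, mul_assoc, mul_inv_cancel₀ hm0, mul_one]

/-- Conditions on the two variables suffice: the coefficient of v obeys a Leibniz rule at the
origin, so its transformation is determined by the images of u and v. -/
theorem mem_originGroup {ψ : Aut2 K}
    (h0 : (ψ (X 0)).IsWeightedHomogeneous (deg2 a b c) (a : ZMod c))
    (h1 : (ψ (X 1)).IsWeightedHomogeneous (deg2 a b c) (b : ZMod c))
    (hc0 : constantCoeff (ψ (X 0)) = 0) (hc1 : constantCoeff (ψ (X 1)) = 0)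
    (hl : b < a → coeff (expo 0 1) (ψ (X 0)) = 0) : ψ ∈ originGroup K a b c := by
  have hc : ∀ p, constantCoeff (ψ p) = constantCoeff p := by
    intro p
    have : constantCoeff.comp ψ.toAlgHom.toRingHom = constantCoeff := by
      apply MvPolynomial.ringHom_ext
      · intro r
        simp [map_C]
      · intro i
        fin_cases i
        · simpa using hc0
        · simpa using hc1
    exact DFunLike.congr_fun this p
  have hψ : ∀ p, ψ p = aeval (fun i => ψ (X i)) p :=
    DFunLike.congr_fun (aeval_unique ψ.toAlgHom)
  refine ⟨fun n p hp => ?_, hc, fun hba => ⟨coeff (expo 0 1) (ψ (X 1)), fun p => ?_⟩⟩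
  · rw [hψ]
    refine isWeightedHomogeneous_aeval (fun i => ?_) hp
    fin_cases i
    · exact h0
    · exact h1
  · have hne : ∀ r : K, coeff (expo 0 1) (C r : MvPolynomial (Fin 2) K) = 0 := by
      intro r
      rw [coeff_C, if_neg]
      intro h
      simpa using DFunLike.congr_fun h 1
    induction p using MvPolynomial.induction_on with
    | C r => rw [map_C, hne, zero_mul]
    | add f g hf hg => rw [map_add, coeff_add, hf, hg, coeff_add, add_mul]
    | mul_X f i hf =>
      rw [map_mul, coeff_expo_zero_one_mul, coeff_expo_zero_one_mul, hf, hc, hc]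
      have h0' : coeff (expo 0 1) (X 0 : MvPolynomial (Fin 2) K) = 0 := by
        rw [coeff_X, if_neg]
        intro h
        simpa using DFunLike.congr_fun h 1
      have h1' : coeff (expo 0 1) (X 1 : MvPolynomial (Fin 2) K) = 1 := by
        rw [coeff_X, if_pos]
        simp [expo]
      fin_cases i
      · simp [hl hba, h0']
      · simp [h1']

theorem homogeneous_of_mem_originGroup {ψ : Aut2 K} (h : ψ ∈ originGroup K a b c) :
    (ψ (X 0)).IsWeightedHomogeneous (deg2 a b c) (a : ZMod c) ∧
      (ψ (X 1)).IsWeightedHomogeneous (deg2 a b c) (b : ZMod c) :=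
  ⟨h.1 _ _ (isWeightedHomogeneous_X K (deg2 a b c) 0),
    h.1 _ _ (isWeightedHomogeneous_X K (deg2 a b c) 1)⟩

theorem constantCoeff_of_mem_originGroup {ψ : Aut2 K} (h : ψ ∈ originGroup K a b c) (i : Fin 2) :
    constantCoeff (ψ (X i)) = 0 := by
  rw [h.2.1, constantCoeff_X]

theorem coeff_of_mem_originGroup {ψ : Aut2 K} (h : ψ ∈ originGroup K a b c) (hab : b < a) :
    coeff (expo 0 1) (ψ (X 0)) = 0 := by
  obtain ⟨m, hm⟩ := h.2.2 hab
  rw [hm, coeff_X, if_neg, zero_mul]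
  intro h
  simpa using DFunLike.congr_fun h 1

/-- The condition on `f` for `(l u + f(v), v)` to preserve the grading and the flag at the
origin. -/
def AdmissibleU (a b c : ℕ) (f : Polynomial K) : Prop :=
  ∀ q, f.coeff q ≠ 0 → 1 ≤ q ∧ (b < a → q ≠ 1) ∧ (q : ZMod c) * b = a

/-- The condition on `g` for `(u, l v + g(u))` to preserve the grading and the origin. -/
def AdmissibleV (a b c : ℕ) (g : Polynomial K) : Prop :=
  ∀ k, g.coeff k ≠ 0 → 1 ≤ k ∧ (k : ZMod c) * a = b

theorem elemU_mem_originGroup (l : Kˣ) {f : Polynomial K} (hf : AdmissibleU a b c f) :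
    elemU l f ∈ originGroup K a b c := by
  have h0 : f.coeff 0 = 0 := by
    by_contra h
    have := (hf 0 h).1
    lia
  refine mem_originGroup ?_ ?_ ?_ ?_ fun hba => ?_
  · rw [elemU_X_zero]
    exact ((isWeightedHomogeneous_X K (deg2 a b c) 0).C_mul _).add
      (homogeneous_atV_iff.2 fun q hq => (hf q hq).2.2)
  · rw [elemU_X_one]
    exact isWeightedHomogeneous_X K (deg2 a b c) 1
  · rw [elemU_X_zero, map_add, ← coeff_expo_zero_zero (atV f), coeff_atV]
    simp [h0]
  · simp
  · have h1 : f.coeff 1 = 0 := by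
      by_contra h
      exact (hf 1 h).2.1 hba rfl
    rw [elemU_X_zero, coeff_add, coeff_C_mul, coeff_X, if_neg, coeff_atV]
    · simp [h1]
    · intro h
      simpa using DFunLike.congr_fun h 1

theorem elemV_mem_originGroup (l : Kˣ) {g : Polynomial K} (hg : AdmissibleV a b c g) :
    elemV l g ∈ originGroup K a b c := by
  have h0 : g.coeff 0 = 0 := by
    by_contra h
    have := (hg 0 h).1
    lia
  refine mem_originGroup ?_ ?_ ?_ ?_ fun hba => ?_
  · rw [elemV_X_zero]
    exact isWeightedHomogeneous_X K (deg2 a b c) 0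
  · rw [elemV_X_one]
    exact ((isWeightedHomogeneous_X K (deg2 a b c) 1).C_mul _).add
      (homogeneous_atU_iff.2 fun q hq => (hg q hq).2)
  · simp
  · rw [elemV_X_one, map_add, ← coeff_expo_zero_zero (atU g), coeff_atU]
    simp [h0]
  · rw [elemV_X_zero, coeff_X, if_neg]
    intro h
    simpa using DFunLike.congr_fun h 1

theorem AdmissibleU.neg_C_mul {f : Polynomial K} (hf : AdmissibleU a b c f) (r : K) :
    AdmissibleU a b c (-(Polynomial.C r * f)) := fun q hq => hf q fun h => by simp [h] at hq

theorem AdmissibleV.neg_C_mul {f : Polynomial K} (hf : AdmissibleV a b c f) (r : K) :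
    AdmissibleV a b c (-(Polynomial.C r * f)) := fun q hq => hf q fun h => by simp [h] at hq

theorem admissibleU_zero : AdmissibleU a b c (0 : Polynomial K) := fun q hq => by simp at hq

theorem admissibleU_monomial {q : ℕ} (r : K) (h1 : 1 ≤ q) (h2 : b < a → q ≠ 1)
    (h3 : (q : ZMod c) * b = a) : AdmissibleU a b c (Polynomial.monomial q r) := by
  intro k hk
  rw [Polynomial.coeff_monomial] at hk
  split_ifs at hk with h
  · subst h; exact ⟨h1, h2, h3⟩
  · exact absurd rfl hk

theorem admissibleV_monomial {q : ℕ} (r : K) (h1 : 1 ≤ q)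
    (h3 : (q : ZMod c) * a = b) : AdmissibleV a b c (Polynomial.monomial q r) := by
  intro k hk
  rw [Polynomial.coeff_monomial] at hk
  split_ifs at hk with h
  · subst h; exact ⟨h1, h3⟩
  · exact absurd rfl hk

end OriginGroup

/-! ### Elementary automorphisms as products from U, W and D -/

section Generators

variable {K : Type*} [Field K] {a b c : ℕ}

theorem modEq_iff_cast {k : ℕ} : k * a ≡ b [MOD c] ↔ (k : ZMod c) * a = b := by
  rw [← ZMod.natCast_eq_natCast_iff]
  push_cast
  rfl

theorem mem_setU_iff (hb : 0 < b) {τ : Aut2 K} : τ ∈ setU K a b c ↔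
    ∃ l f, τ = elemU l f ∧ ∀ q, f.coeff q ≠ 0 → (q : ZMod c) * b = a ∧ a ≤ q * b := by
  have hq : ∀ q : ℕ, (a : ℚ) / b ≤ q ↔ a ≤ q * b := fun q => by
    rw [div_le_iff₀ (by exact_mod_cast hb)]
    exact_mod_cast Iff.rfl
  constructor
  · rintro ⟨l, f, hl, hf, hf', h0, h1⟩
    refine ⟨Units.mk0 l hl, f, aut2_ext ?_ ?_, fun q hq' => ⟨homogeneous_atV_iff.1 hf q hq', ?_⟩⟩
    · rw [h0, elemU_X_zero, Units.val_mk0]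
    · rw [h1, elemU_X_one]
    · exact (hq q).1 (hf' q (Polynomial.mem_support_iff.2 hq'))
  · rintro ⟨l, f, rfl, hf⟩
    exact ⟨l, f, l.ne_zero, homogeneous_atV_iff.2 fun q hq => (hf q hq).1,
      fun q hq' => (hq q).2 (hf q (Polynomial.mem_support_iff.1 hq')).2, by simp, by simp⟩

theorem mem_setW_iff (hb : 0 < b) {τ : Aut2 K} : τ ∈ setW K a b c ↔
    ∃ l f, τ = elemU l f ∧ ∀ q, f.coeff q ≠ 0 → (q : ZMod c) * b = a ∧ 1 < q ∧ q * b < a := by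
  have hq : ∀ q : ℕ, (q : ℚ) < (a : ℚ) / b ↔ q * b < a := fun q => by
    rw [lt_div_iff₀ (by exact_mod_cast hb)]
    exact_mod_cast Iff.rfl
  constructor
  · rintro ⟨l, f, hl, hf, hf', h0, h1⟩
    refine ⟨Units.mk0 l hl, f, aut2_ext ?_ ?_, fun q hq' => ⟨homogeneous_atV_iff.1 hf q hq', ?_⟩⟩
    · rw [h0, elemU_X_zero, Units.val_mk0]
    · rw [h1, elemU_X_one]
    · have := hf' q (Polynomial.mem_support_iff.2 hq')
      exact ⟨this.1, (hq q).1 this.2⟩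
  · rintro ⟨l, f, rfl, hf⟩
    exact ⟨l, f, l.ne_zero, homogeneous_atV_iff.2 fun q hq => (hf q hq).1,
      fun q hq' => ⟨(hf q (Polynomial.mem_support_iff.1 hq')).2.1,
        (hq q).2 (hf q (Polynomial.mem_support_iff.1 hq')).2.2⟩, by simp, by simp⟩

theorem mem_setD_iff {θ : Aut2 K} : θ ∈ setD K a b c ↔
    ∃ (l : Kˣ) (k : ℕ), θ = elemV l (Polynomial.X ^ k) ∧ 1 ≤ k ∧ (k : ZMod c) * a = b := by
  have hX : ∀ k, atU (Polynomial.X ^ k : Polynomial K) = X 0 ^ k := fun k => by simp [atU]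
  constructor
  · rintro ⟨l, k, hl, hk, hk', h0, h1⟩
    refine ⟨Units.mk0 l hl, k, aut2_ext ?_ ?_, hk, modEq_iff_cast.1 hk'⟩
    · rw [h0, elemV_X_zero]
    · rw [h1, elemV_X_one, Units.val_mk0, hX]
  · rintro ⟨l, k, rfl, hk, hk'⟩
    exact ⟨l, k, l.ne_zero, hk, modEq_iff_cast.2 hk', by simp, by simp [hX]⟩

/-- The monoid generated by `U`, `W` and `D`. -/
noncomputable def elemMonoid (K : Type*) [Field K] (a b c : ℕ) : Submonoid (Aut2 K) :=
  Submonoid.closure (setU K a b c ∪ setW K a b c ∪ setD K a b c)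

/-- The terms of f with qb ≥ a go into U, the others into W. For the latter, qb < a forces b < a,
and admissibility then excludes q = 1. -/
theorem elemU_mem_elemMonoid (hb : 0 < b) (l : Kˣ) {f : Polynomial K}
    (hf : AdmissibleU a b c f) : elemU l f ∈ elemMonoid K a b c := by
  classical
  let part : (ℕ → Prop) → Polynomial K := fun P =>
    ∑ q ∈ f.support, if P q then Polynomial.monomial q (f.coeff q) else 0
  have hpart : ∀ P q, (part P).coeff q = if P q then f.coeff q else 0 := by
    intro P q
    simp only [part, Polynomial.finsetSum_coeff]
    rw [Finset.sum_eq_single q]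
    · split_ifs <;> simp
    · intro k _ hk
      split_ifs
      · rw [Polynomial.coeff_monomial, if_neg hk]
      · simp
    · intro h
      rw [Polynomial.notMem_support_iff.1 h]
      simp
  have hsum : elemU l f = elemU l (part fun q => a ≤ q * b) * elemU 1 (part fun q => q * b < a) := by
    rw [elemU_mul, mul_one, Units.val_one, Polynomial.C_1, one_mul]
    congr 1
    ext q
    rw [Polynomial.coeff_add, hpart, hpart]
    by_cases h : a ≤ q * b
    · rw [if_pos h, if_neg (by lia), add_zero]
    · rw [if_neg h, if_pos (by lia), zero_add]
  rw [hsum]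
  refine mul_mem (Submonoid.subset_closure (.inl (.inl ?_)))
    (Submonoid.subset_closure (.inl (.inr ?_)))
  · rw [mem_setU_iff hb]
    refine ⟨_, _, rfl, fun q hq => ?_⟩
    rw [hpart] at hq
    split_ifs at hq with h
    · exact ⟨(hf q hq).2.2, h⟩
    · exact absurd rfl hq
  · rw [mem_setW_iff hb]
    refine ⟨_, _, rfl, fun q hq => ?_⟩
    rw [hpart] at hq
    split_ifs at hq with h
    · obtain ⟨h1, h2, h3⟩ := hf q hq
      have hba : b < a := by nlinarith
      have := h2 hba
      exact ⟨h3, by lia, h⟩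
    · exact absurd rfl hq

/-- In D the power of u always has coefficient 1. A product of two elements whose powers cancel
gives the scalings of v; this needs some admissible k. Conjugation by u ↦ mu with m^k = r gives the
coefficient r. -/
theorem elemV_mem_elemMonoid [IsAlgClosed K] (hb : 0 < b)
    (hk : ∃ k : ℕ, 1 ≤ k ∧ (k : ZMod c) * a = b) (l : Kˣ) {g : Polynomial K}
    (hg : AdmissibleV a b c g) : elemV l g ∈ elemMonoid K a b c := by
  classical
  have hD : ∀ (l : Kˣ) (k : ℕ), 1 ≤ k → (k : ZMod c) * a = b →
      elemV l (Polynomial.X ^ k) ∈ elemMonoid K a b c := fun l k h1 h2 =>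
    Submonoid.subset_closure (.inr (mem_setD_iff.2 ⟨l, k, rfl, h1, h2⟩))
  have hscale : ∀ l : Kˣ, elemV l (0 : Polynomial K) ∈ elemMonoid K a b c := by
    intro l
    obtain ⟨k, h1, h2⟩ := hk
    have : elemV l (0 : Polynomial K)
        = elemV (-l) (Polynomial.X ^ k) * elemV (-1) (Polynomial.X ^ k) := by
      rw [elemV_mul]; simp
    rw [this]
    exact mul_mem (hD _ k h1 h2) (hD _ k h1 h2)
  have hmon : ∀ (k : ℕ) (r : K), r ≠ 0 → 1 ≤ k → (k : ZMod c) * a = b →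
      elemV 1 (Polynomial.monomial k r) ∈ elemMonoid K a b c := by
    intro k r hr h1 h2
    obtain ⟨m, hm⟩ := IsAlgClosed.exists_pow_nat_eq r (by lia : 0 < k)
    have hm0 : m ≠ 0 := by
      rintro rfl
      rw [zero_pow (by lia)] at hm
      exact hr hm.symm
    have : elemV 1 (Polynomial.monomial k r) = elemU (Units.mk0 m hm0) 0 *
        elemV 1 (Polynomial.X ^ k) * elemU (Units.mk0 m hm0)⁻¹ 0 := by
      refine aut2_ext ?_ ?_
      · rw [AlgEquiv.mul_apply, AlgEquiv.mul_apply, elemU_X_zero, elemV_X_zero]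
        simp only [map_add, map_mul, map_C, elemV_X_zero, elemU_X_zero, Units.val_mk0,
          Units.val_inv_eq_inv_val]
        have h3 : C m⁻¹ * C m = (1 : MvPolynomial (Fin 2) K) := by
          rw [← C_mul, inv_mul_cancel₀ hm0, C_1]
        have h4 : atV (0 : Polynomial K) = 0 := map_zero _
        rw [h4, map_zero, map_zero]
        linear_combination -(X 0) * h3
      · rw [AlgEquiv.mul_apply, AlgEquiv.mul_apply, elemU_X_one, elemV_X_one, elemV_X_one,
          map_add, map_mul, map_C, elemU_X_one, atU_monomial, monomial_expo, atU, map_pow,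
          Polynomial.aeval_X, map_pow, elemU_X_zero]
        have h4 : atV (0 : Polynomial K) = 0 := map_zero _
        rw [h4, add_zero, mul_pow, Units.val_mk0, ← C_pow, hm]
        ring
    rw [this]
    exact mul_mem (mul_mem (elemU_mem_elemMonoid hb _ admissibleU_zero) (hD _ k h1 h2))
      (elemU_mem_elemMonoid hb _ admissibleU_zero)
  have hsum : ∀ s ⊆ g.support, ∀ l : Kˣ,
      elemV l (∑ k ∈ s, Polynomial.monomial k (g.coeff k)) ∈ elemMonoid K a b c := by
    intro s
    induction s using Finset.induction_on with
    | empty => intro _ l; simpa using hscale l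
    | insert k s hks ih =>
      intro hs l
      have hgk : g.coeff k ≠ 0 := Polynomial.mem_support_iff.1 (hs (by simp))
      have : elemV l (∑ i ∈ insert k s, Polynomial.monomial i (g.coeff i)) =
          elemV 1 (Polynomial.monomial k ((l : K)⁻¹ * g.coeff k)) *
            elemV l (∑ i ∈ s, Polynomial.monomial i (g.coeff i)) := by
        rw [elemV_mul, one_mul, Finset.sum_insert hks, Polynomial.C_mul_monomial, ← mul_assoc,
          mul_inv_cancel₀ l.ne_zero, one_mul]
      rw [this]
      obtain ⟨h1, h2⟩ := hg k hgk
      exact mul_mem (hmon _ _ (mul_ne_zero (inv_ne_zero l.ne_zero) hgk) h1 h2)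
        (ih (fun i hi => hs (by simp [hi])) l)
  have := hsum g.support subset_rfl l
  rwa [← Polynomial.as_sum_support] at this

end Generators

/-! ### Graded form of Jung's theorem -/

section Generation

variable {K : Type*} [Field K] {a b c : ℕ}

/-- The two monomials differ by exchanging u^q for v^p, and both have the degree of F. -/
theorem cast_mul_eq_of_homogeneous {F : MvPolynomial (Fin 2) K} {p q g : ℕ} {n : ZMod c}
    (hF : F.IsWeightedHomogeneous (deg2 a b c) n) (hg : 0 < g)
    (h1 : coeff (expo (q * g) 0) F ≠ 0) (h2 : coeff (expo (q * (g - 1)) p) F ≠ 0) :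
    (q : ZMod c) * a = p * b := by
  have e1 := hF h1
  have e2 := hF h2
  rw [← e1] at e2
  obtain ⟨g, rfl⟩ := Nat.exists_eq_add_of_le' hg
  simp only [weight_fin_two, expo_zero, expo_one, deg2, Matrix.cons_val_zero,
    Matrix.cons_val_one, nsmul_eq_mul, Nat.add_sub_cancel, Nat.cast_mul,
    Nat.cast_add, Nat.cast_one] at e2
  linear_combination -e2

theorem homogeneous_X_zero (w : Fin 2 → ℤ) :
    (X 0 : MvPolynomial (Fin 2) K).IsWeightedHomogeneous w (w 0) := isWeightedHomogeneous_X K w 0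

theorem homogeneous_X_one (w : Fin 2 → ℤ) :
    (X 1 : MvPolynomial (Fin 2) K).IsWeightedHomogeneous w (w 1) := isWeightedHomogeneous_X K w 1

theorem HasTop.map_aut {w : Fin 2 → ℤ} {n : ℤ} {f f' : MvPolynomial (Fin 2) K} {σ : Aut2 K}
    (h0 : (σ (X 0)).IsWeightedHomogeneous w (w 0)) (h1 : (σ (X 1)).IsWeightedHomogeneous w (w 1))
    (h : HasTop w n f f') : HasTop w n (σ f) (σ f') := by
  have hσ : ∀ p, σ p = MvPolynomial.aeval (fun i => σ (X i)) p :=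
    DFunLike.congr_fun (aeval_unique σ.toAlgHom)
  rw [hσ, hσ]
  refine HasTop.aeval (fun i => ?_) h
  fin_cases i
  · exact .of_homogeneous h0
  · exact .of_homogeneous h1

variable [IsAlgClosed K]

/-- After rescaling, ψ fixes u and is therefore of the form (u, lv + g(u)). -/
theorem mem_elemMonoid_of_apply_X_zero (hb : 0 < b)
    (hk : ∃ k : ℕ, 1 ≤ k ∧ (k : ZMod c) * a = b) {ψ : Aut2 K} (hψ : ψ ∈ originGroup K a b c)
    {r : K} (hr : r ≠ 0) (h : ψ (X 0) = C r * X 0) : ψ ∈ elemMonoid K a b c := by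
  have hs := elemU_mem_originGroup (K := K) (a := a) (b := b) (c := c) (Units.mk0 r hr)⁻¹
    admissibleU_zero
  have h1 : (ψ * elemU (Units.mk0 r hr)⁻¹ 0) (X 0) = X 0 := by
    have h3 : C r⁻¹ * C r = (1 : MvPolynomial (Fin 2) K) := by
      rw [← C_mul, inv_mul_cancel₀ hr, C_1]
    have h4 : atV (0 : Polynomial K) = 0 := map_zero _
    rw [AlgEquiv.mul_apply, elemU_X_zero, map_add, map_mul, map_C, h, h4, map_zero,
      Units.val_inv_eq_inv_val, Units.val_mk0]
    linear_combination (X 0) * h3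
  obtain ⟨l, g, hlg⟩ := exists_eq_elemV h1
  have hmem := mul_mem hψ hs
  rw [hlg] at hmem
  have hg : AdmissibleV a b c g := by
    have e1 := (homogeneous_of_mem_originGroup hmem).2
    have e2 := constantCoeff_of_mem_originGroup hmem 1
    rw [elemV_X_one] at e1 e2
    have e3 := e1.sub ((isWeightedHomogeneous_X K (deg2 a b c) 1).C_mul (l : K))
    rw [add_sub_cancel_left] at e3
    intro k hk
    refine ⟨?_, homogeneous_atU_iff.1 e3 k hk⟩
    by_contra h0
    have h0 : k = 0 := by lia
    subst h0
    rw [map_add, ← coeff_expo_zero_zero (atU g), coeff_atU] at e2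
    simp [hk] at e2
  have : ψ = elemV l g * elemU (Units.mk0 r hr) 0 := by
    rw [← hlg, mul_assoc, elemU_mul]
    simp [elemU_one_zero]
  rw [this]
  exact mul_mem (elemV_mem_elemMonoid hb hk l hg) (elemU_mem_elemMonoid hb _ admissibleU_zero)

/-- Induction on the sum of the two partial degrees of ψ(u). The shape of the leading form supplies
an elementary automorphism in the group that lowers one of them and does not raise the other. -/
theorem originGroup_le_elemMonoid [CharZero K] (hb : 0 < b) (hab : b ≤ a)
    (hk : ∃ k : ℕ, 1 ≤ k ∧ (k : ZMod c) * a = b) {ψ : Aut2 K} (hψ : ψ ∈ originGroup K a b c) :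
    ψ ∈ elemMonoid K a b c := by
  obtain ⟨n, hn⟩ : ∃ n, n = degreeOf 0 (ψ (X 0)) + degreeOf 1 (ψ (X 0)) := ⟨_, rfl⟩
  induction n using Nat.strong_induction_on generalizing ψ with
  | _ n ih =>
  have hconst := constantCoeff_of_mem_originGroup hψ 0
  by_cases h1 : degreeOf 1 (ψ (X 0)) = 0
  · obtain ⟨r, hr, h⟩ := exists_eq_C_mul_X
      (eq_aeval_of_degreeOf_eq_zero (i := 0) (by decide) h1) hconst
    exact mem_elemMonoid_of_apply_X_zero hb hk hψ hr h
  by_cases h0 : degreeOf 0 (ψ (X 0)) = 0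
  · obtain ⟨r, hr, h⟩ := exists_eq_C_mul_X
      (eq_aeval_of_degreeOf_eq_zero (i := 1) (by decide) h0) hconst
    -- For b < a the tangent line u = 0 is preserved, which rules out ψ(u) = rv.
    have hba : a = b := by
      by_contra hne
      have := coeff_of_mem_originGroup hψ (by lia)
      rw [h, coeff_C_mul, coeff_X, if_pos (by simp [expo]), mul_one] at this
      exact hr this
    subst hba
    -- Substituting v ↦ v + u and then u ↦ u - v turns v into u.
    have hU := admissibleU_monomial (K := K) (a := a) (b := a) (c := c) (-1) le_rfl
      (fun h => absurd h (lt_irrefl a)) (by simp)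
    have hV := admissibleV_monomial (K := K) (a := a) (b := a) (c := c) 1 le_rfl (by simp)
    have hmem := mul_mem (mul_mem (elemU_mem_originGroup 1 hU) (elemV_mem_originGroup 1 hV)) hψ
    have hX : (elemU 1 (Polynomial.monomial 1 (-1)) * elemV 1 (Polynomial.monomial 1 1) * ψ :
        Aut2 K) (X 0) = C r * X 0 := by
      rw [AlgEquiv.mul_apply, AlgEquiv.mul_apply, h, map_mul, map_C, elemV_X_one, map_mul, map_C,
        map_add, map_mul, map_C, atU_monomial, monomial_expo]
      simp only [map_mul, map_pow, map_C, elemU_X_zero, elemU_X_one, atV_monomial, monomial_expo]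
      simp
    have := mem_elemMonoid_of_apply_X_zero hb hk hmem hr hX
    have e : ψ = (elemV 1 (Polynomial.monomial 1 1))⁻¹ * ((elemU 1 (Polynomial.monomial 1 (-1)))⁻¹ *
        (elemU 1 (Polynomial.monomial 1 (-1)) * elemV 1 (Polynomial.monomial 1 1) * ψ)) := by
      group
    rw [e, elemU_inv, elemV_inv]
    exact mul_mem (elemV_mem_elemMonoid hb hk _ (hV.neg_C_mul _))
      (mul_mem (elemU_mem_elemMonoid hb _ (hU.neg_C_mul _)) this)
  obtain ⟨p, q, g, hp, hq, hg, hM, hN, hpq, hc1, hc2, l, r, hl, hr, htop⟩ :=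
    exists_topForm ψ (by lia) (by lia)
  have hcast := cast_mul_eq_of_homogeneous (homogeneous_of_mem_originGroup hψ).1 hg hc1 hc2
  have hl1 : C l * C l⁻¹ = (1 : MvPolynomial (Fin 2) K) := by
    rw [← C_mul, mul_inv_cancel₀ hl, C_1]
  -- For p = 1 the substitution v ↦ v + l⁻¹u^q turns u^q - lv into -lv and lowers the degree in u.
  -- This case includes p = q = 1, so the other one has p ≥ 2, as preservation of the tangent line
  -- requires.
  by_cases hp1 : p = 1
  · subst hp1
    obtain ⟨f, hf⟩ : ∃ f : Polynomial K, f = Polynomial.monomial q l⁻¹ := ⟨_, rfl⟩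
    have hV : AdmissibleV a b c f := by
      rw [hf]; exact admissibleV_monomial _ hq (by simpa using hcast)
    have htop' := htop.map_aut (σ := elemV 1 f)
      (by rw [elemV_X_zero]; exact homogeneous_X_zero _) (by
      rw [elemV_X_one, hf, atU_monomial]
      refine ((homogeneous_X_one _).C_mul _).add (isWeightedHomogeneous_monomial _ _ _ ?_)
      simp [weight_fin_two])
    have hform : elemV 1 f (C r * (X 0 ^ q - C l * X 1 ^ 1) ^ g) =
        monomial (expo 0 g) (r * (-l) ^ g) := by
      rw [monomial_expo, map_mul, map_C, map_pow, map_sub, map_mul, map_C, map_pow, map_pow,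
        elemV_X_zero, elemV_X_one, hf, atU_monomial, monomial_expo, C_mul, C_pow, C_neg,
        Units.val_one, C_1]
      have : X 0 ^ q - C l * (1 * X 1 + C l⁻¹ * X 0 ^ q * X 1 ^ 0) ^ 1 =
          (-C l * X 1 : MvPolynomial (Fin 2) K) := by
        linear_combination (-X 0 ^ q) * hl1
      rw [this]
      ring
    rw [hform] at htop'
    have hw : ∀ d, coeff d (elemV 1 f (ψ (X 0))) ≠ 0 → d 0 + d 1 * q ≤ q * g := by
      intro d hd
      have := htop'.weightAtMost d hd
      simp only [weight_fin_two, Matrix.cons_val_zero, Matrix.cons_val_one, nsmul_eq_mul] at this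
      have h2 : ((d 0 + d 1 * q : ℕ) : ℤ) ≤ ((q * g : ℕ) : ℤ) := by
        push_cast at this ⊢
        linarith
      exact_mod_cast h2
    have hmem := mul_mem (elemV_mem_originGroup 1 hV) hψ
    have hmul : (elemV 1 f * ψ) (X 0) = elemV 1 f (ψ (X 0)) := AlgEquiv.mul_apply _ _ _
    have hlt : degreeOf 0 ((elemV 1 f * ψ) (X 0)) < degreeOf 0 (ψ (X 0)) := by
      rw [hmul, degreeOf_lt_iff (by lia), hM]
      intro d hd
      have hd := mem_support_iff.1 hd
      have h2 := hw d hd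
      by_contra! h3
      have h4 : d 1 = 0 := by
        rcases Nat.mul_eq_zero.1 (show d 1 * q = 0 by lia) with h | h <;> lia
      have h5 := htop'.coeff_eq (d := d) (by
        simp only [weight_fin_two, h4, Matrix.cons_val_zero, nsmul_eq_mul]
        have : d 0 = q * g := by lia
        rw [this]; simp)
      rw [h5, coeff_monomial, if_neg] at hd
      · exact hd rfl
      · intro h6
        have := DFunLike.congr_fun h6 1
        rw [expo_one] at this
        lia
    have hle : degreeOf 1 ((elemV 1 f * ψ) (X 0)) ≤ degreeOf 1 (ψ (X 0)) := by
      rw [hmul, degreeOf_le_iff, hN]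
      intro d hd
      have h2 := hw d (mem_support_iff.1 hd)
      have : q * d 1 ≤ q * g := by lia
      have := Nat.le_of_mul_le_mul_left this hq
      lia
    have := ih _ (by lia) hmem rfl
    have e : ψ = (elemV 1 f)⁻¹ * (elemV 1 f * ψ) := by group
    rw [e, elemV_inv]
    exact mul_mem (elemV_mem_elemMonoid hb hk _ (hV.neg_C_mul _)) this
  · have hq1 : q = 1 := hpq.resolve_left hp1
    subst hq1
    -- Substituting u ↦ u + lv^p turns u - lv^p into u and lowers the degree in v.
    obtain ⟨f, hf⟩ : ∃ f : Polynomial K, f = Polynomial.monomial p l := ⟨_, rfl⟩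
    have hU : AdmissibleU a b c f := by
      rw [hf]
      refine admissibleU_monomial _ hp (fun _ => hp1) (by simpa using hcast.symm)
    have htop' := htop.map_aut (σ := elemU 1 f) (by
      rw [elemU_X_zero, hf, atV_monomial]
      refine ((homogeneous_X_zero _).C_mul _).add (isWeightedHomogeneous_monomial _ _ _ ?_)
      simp [weight_fin_two]) (by rw [elemU_X_one]; exact homogeneous_X_one _)
    have hform : elemU 1 f (C r * (X 0 ^ 1 - C l * X 1 ^ p) ^ g) = monomial (expo g 0) r := by
      rw [monomial_expo, map_mul, map_C, map_pow, map_sub, map_mul, map_C, map_pow, map_pow,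
        elemU_X_zero, elemU_X_one, hf, atV_monomial, monomial_expo, Units.val_one, C_1]
      have : (1 * X 0 + C l * X 0 ^ 0 * X 1 ^ p) ^ 1 - C l * X 1 ^ p =
          (X 0 : MvPolynomial (Fin 2) K) := by ring
      rw [this]
      ring
    rw [hform] at htop'
    have hw : ∀ d, coeff d (elemU 1 f (ψ (X 0))) ≠ 0 → d 0 * p + d 1 ≤ p * g := by
      intro d hd
      have := htop'.weightAtMost d hd
      simp only [weight_fin_two, Matrix.cons_val_zero, Matrix.cons_val_one, nsmul_eq_mul] at this
      have h2 : ((d 0 * p + d 1 : ℕ) : ℤ) ≤ ((p * g : ℕ) : ℤ) := by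
        push_cast at this ⊢
        linarith
      exact_mod_cast h2
    have hmem := mul_mem (elemU_mem_originGroup 1 hU) hψ
    have hmul : (elemU 1 f * ψ) (X 0) = elemU 1 f (ψ (X 0)) := AlgEquiv.mul_apply _ _ _
    have hlt : degreeOf 1 ((elemU 1 f * ψ) (X 0)) < degreeOf 1 (ψ (X 0)) := by
      rw [hmul, degreeOf_lt_iff (by lia), hN]
      intro d hd
      have hd := mem_support_iff.1 hd
      have h2 := hw d hd
      by_contra! h3
      have h4 : d 0 = 0 := by
        rcases Nat.mul_eq_zero.1 (show d 0 * p = 0 by lia) with h | h <;> lia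
      have h5 := htop'.coeff_eq (d := d) (by
        simp only [weight_fin_two, h4, Matrix.cons_val_one, nsmul_eq_mul]
        have : d 1 = p * g := by lia
        rw [this]; simp)
      rw [h5, coeff_monomial, if_neg] at hd
      · exact hd rfl
      · intro h6
        have := DFunLike.congr_fun h6 0
        rw [expo_zero] at this
        lia
    have hle : degreeOf 0 ((elemU 1 f * ψ) (X 0)) ≤ degreeOf 0 (ψ (X 0)) := by
      rw [hmul, degreeOf_le_iff, hM]
      intro d hd
      have h2 := hw d (mem_support_iff.1 hd)
      have : p * d 0 ≤ p * g := by lia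
      have := Nat.le_of_mul_le_mul_left this hp
      lia
    have := ih _ (by lia) hmem rfl
    have e : ψ = (elemU 1 f)⁻¹ * (elemU 1 f * ψ) := by group
    rw [e, elemU_inv]
    exact mul_mem (elemU_mem_elemMonoid hb _ (hU.neg_C_mul _)) this

end Generation

/-! ### Lifting plane automorphisms to graded automorphisms of space -/

section Lifting

variable {K : Type*} [Field K] {a b c : ℕ}

/-- The exponent of `x^i y^j z^k`. -/
noncomputable def expo3 (i j k : ℕ) : Fin 3 →₀ ℕ :=
  Finsupp.single 0 i + Finsupp.single 1 j + Finsupp.single 2 k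

theorem eq_expo3 (d : Fin 3 →₀ ℕ) : d = expo3 (d 0) (d 1) (d 2) := by
  ext i
  fin_cases i <;> simp [expo3]

@[simp] theorem expo3_zero (i j k : ℕ) : expo3 i j k 0 = i := by simp [expo3]

@[simp] theorem expo3_one (i j k : ℕ) : expo3 i j k 1 = j := by simp [expo3]

@[simp] theorem expo3_two (i j k : ℕ) : expo3 i j k 2 = k := by simp [expo3]

theorem weight_deg3 (d : Fin 3 →₀ ℕ) :
    Finsupp.weight (deg3 a b c) d = ((d 0 * a + d 1 * b : ℕ) : ℤ) - ((d 2 * c : ℕ) : ℤ) := by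
  simp [Finsupp.weight_apply, Finsupp.sum_fintype, Fin.sum_univ_three, deg3]
  ring

theorem restrict_monomial (d : Fin 3 →₀ ℕ) (r : K) :
    restrict K (monomial d r) = monomial (expo (d 0) (d 1)) r := by
  rw [restrict, aeval_monomial, Finsupp.prod_fintype _ _ (by simp), Fin.prod_univ_three,
    monomial_expo]
  simp [mul_assoc]

/-- The homogenization of degree `n`, a linear section of the restriction to `z = 1`. -/
noncomputable def homogenization (K : Type*) [Field K] (a b c : ℕ) (n : ℤ) :
    MvPolynomial (Fin 2) K →ₗ[K] MvPolynomial (Fin 3) K :=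
  (basisMonomials (Fin 2) K).constr K fun d =>
    monomial (expo3 (d 0) (d 1) ((((d 0 * a + d 1 * b : ℕ) : ℤ) - n) / c).toNat) 1

theorem homogenization_monomial (n : ℤ) (d : Fin 2 →₀ ℕ) (r : K) :
    homogenization K a b c n (monomial d r) =
      monomial (expo3 (d 0) (d 1) ((((d 0 * a + d 1 * b : ℕ) : ℤ) - n) / c).toNat) r := by
  have h : monomial d r = r • basisMonomials (Fin 2) K d := by
    rw [coe_basisMonomials, smul_monomial, smul_eq_mul, mul_one]
  rw [h, map_smul, homogenization, Module.Basis.constr_basis, smul_monomial, smul_eq_mul, mul_one]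

/-- In a fixed degree the exponents of x and y determine that of z, because c is nonzero. -/
theorem homogenization_restrict (hc : 0 < c) {n : ℤ} {f : MvPolynomial (Fin 3) K}
    (hf : f ∈ component K a b c n) : homogenization K a b c n (restrict K f) = f := by
  conv_rhs => rw [f.as_sum]
  conv_lhs => rw [f.as_sum]
  rw [map_sum, map_sum]
  refine Finset.sum_congr rfl fun d hd => ?_
  have h : Finsupp.weight (deg3 a b c) d = n := hf (mem_support_iff.1 hd)
  rw [weight_deg3] at h
  rw [restrict_monomial, homogenization_monomial]
  congr 1
  rw [expo_zero, expo_one, show (((d 0 * a + d 1 * b : ℕ) : ℤ) - n) = (d 2 : ℤ) * c by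
    push_cast at h ⊢; lia, Int.mul_ediv_cancel _ (by exact_mod_cast hc.ne'), Int.toNat_natCast,
    ← eq_expo3]

theorem restrict_injOn (hc : 0 < c) {n : ℤ} {f g : MvPolynomial (Fin 3) K}
    (hf : f ∈ component K a b c n) (hg : g ∈ component K a b c n)
    (h : restrict K f = restrict K g) : f = g := by
  rw [← homogenization_restrict hc hf, h, homogenization_restrict hc hg]

theorem weight_of_coeff_restrict {n : ℤ} {f : MvPolynomial (Fin 3) K}
    (hf : f ∈ component K a b c n) {d : Fin 2 →₀ ℕ} (hd : coeff d (restrict K f) ≠ 0) :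
    n ≤ ((d 0 * a + d 1 * b : ℕ) : ℤ) ∧ (d 0 : ZMod c) * a + d 1 * b = n := by
  classical
  rw [f.as_sum, map_sum, coeff_sum] at hd
  obtain ⟨e, he, hne⟩ := Finset.exists_ne_zero_of_sum_ne_zero hd
  rw [restrict_monomial, coeff_monomial] at hne
  split_ifs at hne with h
  · have hw : Finsupp.weight (deg3 a b c) e = n := hf (mem_support_iff.1 he)
    rw [weight_deg3] at hw
    subst h
    rw [expo_zero, expo_one]
    constructor
    · have : (0 : ℤ) ≤ ((e 2 * c : ℕ) : ℤ) := Int.natCast_nonneg _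
      lia
    · rw [← hw]
      simp
  · exact absurd rfl hne

/-- The exponent (ai + bj - n)/c of z is an integer by homogeneity modulo c, and nonnegative by the
inequality. -/
theorem exists_restrict_eq (hc : 0 < c) {n : ℤ} {p : MvPolynomial (Fin 2) K}
    (hp : ∀ d, coeff d p ≠ 0 → n ≤ ((d 0 * a + d 1 * b : ℕ) : ℤ))
    (hp' : p.IsWeightedHomogeneous (deg2 a b c) (n : ZMod c)) :
    ∃ f ∈ component K a b c n, restrict K f = p := by
  have key : ∀ d, coeff d p ≠ 0 → ∃ k : ℕ,
      ((((d 0 * a + d 1 * b : ℕ) : ℤ) - n) / c).toNat = k ∧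
        ((d 0 * a + d 1 * b : ℕ) : ℤ) - n = ((k * c : ℕ) : ℤ) := by
    intro d hd
    have h1 := hp d hd
    have h2 := hp' hd
    rw [weight_fin_two] at h2
    have h3 : (c : ℤ) ∣ ((d 0 * a + d 1 * b : ℕ) : ℤ) - n := by
      rw [← ZMod.intCast_eq_intCast_iff_dvd_sub, ← h2]
      simp [deg2]
    obtain ⟨k, hk⟩ := h3
    have hc' : (0 : ℤ) < c := by exact_mod_cast hc
    have hk0 : 0 ≤ k := by
      by_contra! h
      nlinarith
    lift k to ℕ using hk0
    refine ⟨k, ?_, by rw [hk]; push_cast; ring⟩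
    rw [hk, Int.mul_ediv_cancel_left _ hc'.ne', Int.toNat_natCast]
  refine ⟨homogenization K a b c n p, ?_, ?_⟩
  · rw [p.as_sum, map_sum]
    refine Submodule.sum_mem _ fun d hd => ?_
    obtain ⟨k, hk, hk'⟩ := key d (mem_support_iff.1 hd)
    rw [homogenization_monomial, hk]
    refine isWeightedHomogeneous_monomial _ _ _ ?_
    rw [weight_deg3, expo3_zero, expo3_one, expo3_two]
    lia
  · conv_rhs => rw [p.as_sum]
    conv_lhs => rw [p.as_sum]
    rw [map_sum, map_sum]
    refine Finset.sum_congr rfl fun d _ => ?_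
    rw [homogenization_monomial, restrict_monomial, expo3_zero, expo3_one, ← eq_expo]

theorem X_mem_component (i : Fin 3) : X i ∈ component K a b c (deg3 a b c i) :=
  isWeightedHomogeneous_X K (deg3 a b c) i

theorem X_zero_mem_component : (X 0 : MvPolynomial (Fin 3) K) ∈ component K a b c a :=
  X_mem_component 0

theorem X_one_mem_component : (X 1 : MvPolynomial (Fin 3) K) ∈ component K a b c b :=
  X_mem_component 1

theorem X_two_mem_component : (X 2 : MvPolynomial (Fin 3) K) ∈ component K a b c (-c) :=
  X_mem_component 2

theorem restrict_X_zero : restrict K (X 0) = X 0 := by simp [restrict]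

theorem restrict_X_one : restrict K (X 1) = X 1 := by simp [restrict]

theorem restrict_X_two : restrict K (X 2) = 1 := by simp [restrict]

/-- The endomorphism `ψ` of the plane comes from a graded endomorphism of `K[x,y,z]` that
fixes `z`. -/
def IsLiftable (a b c : ℕ) (ψ : Aut2 K) : Prop :=
  ∃ Φ : MvPolynomial (Fin 3) K →ₐ[K] MvPolynomial (Fin 3) K, Φ (X 2) = X 2 ∧
    (∀ n, ∀ p ∈ component K a b c n, Φ p ∈ component K a b c n) ∧
    ∀ p, restrict K (Φ p) = ψ (restrict K p)

theorem IsLiftable.mul {φ ψ : Aut2 K} (hφ : IsLiftable a b c φ) (hψ : IsLiftable a b c ψ) :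
    IsLiftable a b c (φ * ψ) := by
  obtain ⟨Φ, h1, h2, h3⟩ := hφ
  obtain ⟨Ψ, h1', h2', h3'⟩ := hψ
  refine ⟨Φ.comp Ψ, by rw [AlgHom.comp_apply, h1', h1], fun n p hp => h2 n _ (h2' n p hp),
    fun p => ?_⟩
  rw [AlgHom.comp_apply, h3, h3', AlgEquiv.mul_apply]

theorem isLiftable_of_restrict {ψ : Aut2 K} {f g : MvPolynomial (Fin 3) K}
    (hf : f ∈ component K a b c a) (hg : g ∈ component K a b c b)
    (hf' : restrict K f = ψ (X 0)) (hg' : restrict K g = ψ (X 1)) : IsLiftable a b c ψ := by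
  refine ⟨aeval ![f, g, X 2], by simp, fun n p hp => ?_, fun p => ?_⟩
  · refine isWeightedHomogeneous_aeval (fun i => ?_) hp
    fin_cases i
    · exact hf
    · exact hg
    · exact X_two_mem_component
  · have : (restrict K).comp (aeval ![f, g, X 2]) = ψ.toAlgHom.comp (restrict K) := by
      ext1 i
      fin_cases i
      · simp [hf', restrict_X_zero]
      · simp [hg', restrict_X_one]
      · simp [restrict_X_two]
    exact DFunLike.congr_fun this p

/-- Only the image of u needs a hypothesis: the image of v has no constant term, and b ≤ a gives
every other monomial weight at least b. -/
theorem isLiftable_of_mem_originGroup (hc : 0 < c) (hab : b ≤ a) {ψ : Aut2 K}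
    (hψ : ψ ∈ originGroup K a b c)
    (h : ∀ d, coeff d (ψ (X 0)) ≠ 0 → a ≤ d 0 * a + d 1 * b) : IsLiftable a b c ψ := by
  obtain ⟨h0, h1⟩ := homogeneous_of_mem_originGroup hψ
  obtain ⟨f, hf, hf'⟩ := exists_restrict_eq (K := K) (a := a) (b := b) hc (n := a)
    (fun d hd => by exact_mod_cast h d hd) (by simpa using h0)
  obtain ⟨g, hg, hg'⟩ := exists_restrict_eq (K := K) (a := a) (b := b) hc (n := b)
    (p := ψ (X 1)) (fun d hd => by
      have hne : d 0 ≠ 0 ∨ d 1 ≠ 0 := by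
        by_contra! h2
        rw [eq_expo d, h2.1, h2.2, coeff_expo_zero_zero,
          constantCoeff_of_mem_originGroup hψ] at hd
        exact hd rfl
      have : b ≤ d 0 * a + d 1 * b := by
        rcases hne with h2 | h2
        · exact hab.trans ((Nat.le_mul_of_pos_left a (Nat.pos_of_ne_zero h2)).trans
            (Nat.le_add_right _ _))
        · exact (Nat.le_mul_of_pos_left b (Nat.pos_of_ne_zero h2)).trans (Nat.le_add_left _ _)
      exact_mod_cast this) (by simpa using h1)
  exact isLiftable_of_restrict hf hg hf' hg'

theorem IsLiftable.le_weight {ψ : Aut2 K} (h : IsLiftable a b c ψ) {d : Fin 2 →₀ ℕ}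
    (hd : coeff d (ψ (X 0)) ≠ 0) : a ≤ d 0 * a + d 1 * b := by
  obtain ⟨Φ, h1, h2, h3⟩ := h
  rw [← restrict_X_zero, ← h3] at hd
  exact_mod_cast (weight_of_coeff_restrict (h2 _ _ X_zero_mem_component) hd).1

theorem alpha_apply (φ : groupE K a b c) (p : MvPolynomial (Fin 3) K) :
    alpha K a b c φ (restrict K p) = restrict K (φ.1 p) :=
  alphaHom_restrict φ.2.2 p

theorem isLiftable_alpha (φ : groupE K a b c) : IsLiftable a b c (alpha K a b c φ) :=
  ⟨φ.1.toAlgHom, φ.2.2, φ.2.1, fun p => (alpha_apply φ p).symm⟩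

theorem alpha_injective (hc : 0 < c) : Function.Injective (alpha K a b c) := by
  intro φ ψ h
  have h1 : ∀ i, φ.1 (X i) = ψ.1 (X i) := fun i =>
    restrict_injOn hc (φ.2.1 _ _ (X_mem_component i)) (ψ.2.1 _ _ (X_mem_component i)) (by
      rw [← alpha_apply, ← alpha_apply, h])
  apply Subtype.ext
  have : φ.1.toAlgHom = ψ.1.toAlgHom := by
    ext1 i
    exact h1 i
  exact AlgEquiv.coe_toAlgHom_injective this

/-- The lifts of ψ and ψ⁻¹ are mutually inverse, since a homogeneous polynomial is determined by its
restriction. -/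
theorem mem_range_alpha (hc : 0 < c) {ψ : Aut2 K} (h : IsLiftable a b c ψ)
    (h' : IsLiftable a b c ψ⁻¹) : ψ ∈ (alpha K a b c).range := by
  obtain ⟨Φ, h1, h2, h3⟩ := h
  obtain ⟨Ψ, h1', h2', h3'⟩ := h'
  have e1 : Φ.comp Ψ = AlgHom.id K _ := by
    ext1 i
    refine restrict_injOn hc (h2 _ _ (h2' _ _ (X_mem_component i))) (X_mem_component i) ?_
    rw [AlgHom.comp_apply, h3, h3', ← AlgEquiv.mul_apply, mul_inv_cancel, AlgEquiv.one_apply,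
      AlgHom.id_apply]
  have e2 : Ψ.comp Φ = AlgHom.id K _ := by
    ext1 i
    refine restrict_injOn hc (h2' _ _ (h2 _ _ (X_mem_component i))) (X_mem_component i) ?_
    rw [AlgHom.comp_apply, h3', h3, ← AlgEquiv.mul_apply, inv_mul_cancel, AlgEquiv.one_apply,
      AlgHom.id_apply]
  let φ : groupE K a b c := ⟨AlgEquiv.ofAlgHom Φ Ψ e1 e2, h2, h1⟩
  refine ⟨φ, aut2_ext ?_ ?_⟩
  · rw [← restrict_X_zero, alpha_apply]
    exact h3 _
  · rw [← restrict_X_one, alpha_apply]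
    exact h3 _

/-- Weight at least a excludes constants from the image of u, and also v when b < a; weight at least
b excludes constants from the image of v. -/
theorem alpha_mem_originGroup (ha : 0 < a) (hb : 0 < b) (φ : groupE K a b c) :
    alpha K a b c φ ∈ originGroup K a b c := by
  have h0 := φ.2.1 _ _ X_zero_mem_component
  have h1 := φ.2.1 _ _ X_one_mem_component
  have e0 : alpha K a b c φ (X 0) = restrict K (φ.1 (X 0)) := by
    rw [← alpha_apply, restrict_X_zero]
  have e1 : alpha K a b c φ (X 1) = restrict K (φ.1 (X 1)) := by
    rw [← alpha_apply, restrict_X_one]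
  refine mem_originGroup ?_ ?_ ?_ ?_ fun hba => ?_
  · rw [e0]
    intro d hd
    simpa [weight_fin_two, deg2] using (weight_of_coeff_restrict h0 hd).2
  · rw [e1]
    intro d hd
    simpa [weight_fin_two, deg2] using (weight_of_coeff_restrict h1 hd).2
  · rw [e0, ← coeff_expo_zero_zero]
    by_contra hd
    have := (weight_of_coeff_restrict h0 hd).1
    rw [expo_zero, expo_one] at this
    lia
  · rw [e1, ← coeff_expo_zero_zero]
    by_contra hd
    have := (weight_of_coeff_restrict h1 hd).1
    rw [expo_zero, expo_one] at this
    lia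
  · rw [e0]
    by_contra hd
    have := (weight_of_coeff_restrict h0 hd).1
    rw [expo_zero, expo_one] at this
    lia

end Lifting

/-! ### Corrections by elements of W -/

section Corrections

variable {K : Type*} [Field K] {a b c : ℕ}

theorem coeff_expo_one_apply_ne_zero {ψ : Aut2 K} (hψ : ψ ∈ originGroup K a b c) (hab : b < a) :
    coeff (expo 0 1) (ψ (X 1)) ≠ 0 := by
  obtain ⟨m, hm⟩ := hψ.2.2 hab
  have hX : coeff (expo 0 1) (X 1 : MvPolynomial (Fin 2) K) = 1 := by
    rw [coeff_X, if_pos]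
    simp [expo]
  have h1 := hm (ψ.symm (X 1))
  rw [AlgEquiv.apply_symm_apply, hX] at h1
  rw [hm, hX, one_mul]
  rintro rfl
  simp at h1

theorem admissibleU_of_one_lt {f : Polynomial K}
    (hf : ∀ q, f.coeff q ≠ 0 → (q : ZMod c) * b = a ∧ 1 < q) : AdmissibleU a b c f :=
  fun q hq => ⟨(hf q hq).2.le, fun _ => (hf q hq).2.ne', (hf q hq).1⟩

/-- The powers v^j in the image of u are removed in increasing order of j. Adding a multiple of
ψ(v)^n alters the coefficient of v^n without disturbing lower ones, because ψ(v) has a nonzero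
linear term in v. -/
theorem exists_truncated_correction {ψ : Aut2 K} (hψ : ψ ∈ originGroup K a b c) (hab : b < a)
    {n : ℕ} (hn : 2 ≤ n) :
    ∃ h : Polynomial K, (∀ q, h.coeff q ≠ 0 → ((q : ZMod c) * b = a ∧ 1 < q) ∧ q < n) ∧
      ∀ j < n, coeff (expo 0 j) ((ψ * elemU 1 h) (X 0)) = 0 := by
  induction n, hn using Nat.le_induction with
  | base =>
    refine ⟨0, fun q hq => by simp at hq, fun j hj => ?_⟩
    rw [elemU_one_zero, mul_one]
    interval_cases j
    · rw [coeff_expo_zero_zero, constantCoeff_of_mem_originGroup hψ]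
    · exact coeff_of_mem_originGroup hψ hab
  | succ n hn ih =>
    obtain ⟨h, hh, hcoeff⟩ := ih
    have hU := admissibleU_of_one_lt fun q hq => (hh q hq).1
    have hmem := mul_mem hψ (elemU_mem_originGroup 1 hU)
    by_cases hr : coeff (expo 0 n) ((ψ * elemU 1 h) (X 0)) = 0
    · refine ⟨h, fun q hq => ⟨(hh q hq).1, (hh q hq).2.trans (Nat.lt_succ_self n)⟩, fun j hj => ?_⟩
      rcases Nat.lt_succ_iff_lt_or_eq.1 hj with hj | rfl
      · exact hcoeff j hj
      · exact hr
    obtain ⟨r, hr'⟩ : ∃ r, r = coeff (expo 0 n) ((ψ * elemU 1 h) (X 0)) := ⟨_, rfl⟩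
    -- A surviving v^n has the degree of u modulo c, so the exponent n is allowed in W.
    have hnb : (n : ZMod c) * b = a := by
      simpa [weight_fin_two, deg2] using (homogeneous_of_mem_originGroup hmem).1 hr
    obtain ⟨m, hm⟩ : ∃ m, m = coeff (expo 0 1) (ψ (X 1)) := ⟨_, rfl⟩
    have hm0 : m ≠ 0 := hm ▸ coeff_expo_one_apply_ne_zero hψ hab
    refine ⟨h + Polynomial.monomial n (-(r * (m ^ n)⁻¹)), fun q hq => ?_, fun j hj => ?_⟩
    · rw [Polynomial.coeff_add, Polynomial.coeff_monomial] at hq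
      by_cases hqn : n = q
      · subst hqn
        exact ⟨⟨hnb, by lia⟩, Nat.lt_succ_self n⟩
      · rw [if_neg hqn, add_zero] at hq
        exact ⟨(hh q hq).1, (hh q hq).2.trans (Nat.lt_succ_self n)⟩
    · have e : (ψ * elemU 1 (h + Polynomial.monomial n (-(r * (m ^ n)⁻¹)))) (X 0) =
          (ψ * elemU 1 h) (X 0) + C (-(r * (m ^ n)⁻¹)) * ψ (X 1) ^ n := by
        rw [AlgEquiv.mul_apply, AlgEquiv.mul_apply, elemU_X_zero, elemU_X_zero, atV_add,
          atV_monomial, monomial_expo, pow_zero, mul_one, ← add_assoc, map_add, map_mul, map_C,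
          map_pow]
      rw [e, coeff_add, coeff_C_mul,
        coeff_expo_zero_pow (constantCoeff_of_mem_originGroup hψ 1) (Nat.lt_succ_iff.1 hj)]
      split_ifs with hjn
      · rw [hjn, ← hr', ← hm]
        field_simp
        ring
      · rw [hcoeff j (by lia), mul_zero, zero_add]

theorem one_mem_setW (hb : 0 < b) : (1 : Aut2 K) ∈ setW K a b c :=
  (mem_setW_iff hb).2 ⟨1, 0, elemU_one_zero.symm, fun q hq => by simp at hq⟩

theorem exists_liftable_mul (hb : 0 < b) (hc : 0 < c) (hab : b ≤ a) {ψ : Aut2 K}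
    (hψ : ψ ∈ originGroup K a b c) : ∃ s ∈ setW K a b c, IsLiftable a b c (ψ * s) := by
  rcases hab.eq_or_lt with rfl | hlt
  · refine ⟨1, one_mem_setW hb, ?_⟩
    rw [mul_one]
    refine isLiftable_of_mem_originGroup hc le_rfl hψ fun d hd => ?_
    have hne : 0 < d 0 + d 1 := by
      by_contra! h2
      rw [eq_expo d, show d 0 = 0 by lia, show d 1 = 0 by lia, coeff_expo_zero_zero,
        constantCoeff_of_mem_originGroup hψ] at hd
      exact hd rfl
    rw [← add_mul]
    exact Nat.le_mul_of_pos_left b hne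
  · have hex : ∃ n, 2 ≤ n ∧ a ≤ n * b := ⟨a + 2, by lia, by nlinarith⟩
    classical
    obtain ⟨n, ⟨hn, hna⟩, hmin⟩ : ∃ n, (2 ≤ n ∧ a ≤ n * b) ∧ ∀ m < n, ¬ (2 ≤ m ∧ a ≤ m * b) :=
      ⟨Nat.find hex, Nat.find_spec hex, fun m hm => Nat.find_min hex hm⟩
    obtain ⟨h, hh, hcoeff⟩ := exists_truncated_correction hψ hlt hn
    have hU := admissibleU_of_one_lt fun q hq => (hh q hq).1
    have hmem := mul_mem hψ (elemU_mem_originGroup 1 hU)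
    refine ⟨elemU 1 h, (mem_setW_iff hb).2 ⟨1, h, rfl, fun q hq => ?_⟩,
      isLiftable_of_mem_originGroup hc hab hmem fun d hd => ?_⟩
    · obtain ⟨⟨h1, h2⟩, h3⟩ := hh q hq
      have := hmin q h3
      exact ⟨h1, h2, by by_contra! h4; exact this ⟨h2, h4⟩⟩
    · by_cases h0 : d 0 = 0
      · rw [eq_expo d, h0] at hd
        have : n ≤ d 1 := by
          by_contra! h1
          exact hd (hcoeff _ h1)
        exact (hna.trans (Nat.mul_le_mul_right b this)).trans (Nat.le_add_left _ _)
      · exact (Nat.le_mul_of_pos_left a (Nat.pos_of_ne_zero h0)).trans (Nat.le_add_right _ _)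

theorem setW_subset_originGroup (hb : 0 < b) {τ : Aut2 K} (hτ : τ ∈ setW K a b c) :
    τ ∈ originGroup K a b c := by
  obtain ⟨l, f, rfl, hf⟩ := (mem_setW_iff hb).1 hτ
  exact elemU_mem_originGroup l (admissibleU_of_one_lt fun q hq => ⟨(hf q hq).1, (hf q hq).2.1⟩)

theorem setU_subset_originGroup (ha : 0 < a) (hb : 0 < b) {τ : Aut2 K}
    (hτ : τ ∈ setU K a b c) : τ ∈ originGroup K a b c := by
  obtain ⟨l, f, rfl, hf⟩ := (mem_setU_iff hb).1 hτ
  refine elemU_mem_originGroup l fun q hq => ⟨?_, fun hba => ?_, (hf q hq).1⟩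
  · by_contra! h
    have := (hf q hq).2
    rw [show q = 0 by lia] at this
    lia
  · rintro rfl
    have := (hf 1 hq).2
    lia

theorem setD_subset_originGroup {θ : Aut2 K} (hθ : θ ∈ setD K a b c) :
    θ ∈ originGroup K a b c := by
  obtain ⟨l, k, rfl, h1, h2⟩ := mem_setD_iff.1 hθ
  rw [← Polynomial.monomial_one_right_eq_X_pow]
  exact elemV_mem_originGroup l (admissibleV_monomial 1 h1 h2)

/-- Each monomial v^q permitted in W has weight qb < a, too small for the image of u under a
liftable map. -/
theorem eq_elemU_zero_of_liftable (hb : 0 < b) {s : Aut2 K} (hs : s ∈ setW K a b c)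
    (h : IsLiftable a b c s) : ∃ l, s = elemU l 0 := by
  obtain ⟨l, f, rfl, hf⟩ := (mem_setW_iff hb).1 hs
  refine ⟨l, ?_⟩
  congr 1
  ext q
  rw [Polynomial.coeff_zero]
  by_contra hq
  have := h.le_weight (d := expo 0 q) (by
    rw [elemU_X_zero, coeff_add, coeff_C_mul, coeff_X, if_neg, mul_zero, zero_add, coeff_atV]
    · simpa using hq
    · intro h
      simpa using DFunLike.congr_fun h 0)
  have h2 := (hf q hq).2.2
  rw [expo_zero, expo_one] at this
  lia

theorem isLiftable_elemU (hc : 0 < c) (hab : b ≤ a) (l : Kˣ) {f : Polynomial K}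
    (hmem : elemU l f ∈ originGroup K a b c) (hf : ∀ q, f.coeff q ≠ 0 → a ≤ q * b) :
    IsLiftable a b c (elemU l f) := by
  refine isLiftable_of_mem_originGroup hc hab hmem fun d hd => ?_
  by_cases h0 : d 0 = 0
  · rw [elemU_X_zero, coeff_add, coeff_C_mul, coeff_X, if_neg, mul_zero, zero_add, coeff_atV,
      if_pos h0] at hd
    · exact (hf _ hd).trans (Nat.le_add_left _ _)
    · rintro rfl
      simp at h0
  · exact (Nat.le_mul_of_pos_left a (Nat.pos_of_ne_zero h0)).trans (Nat.le_add_right _ _)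

/-- Liftability of the inverse is automatic. If s in W makes ψ⁻¹s liftable, then s = ψ(ψ⁻¹s) is
liftable, hence a scaling, and can be cancelled. -/
theorem mem_range_alpha_of_liftable (hb : 0 < b) (hc : 0 < c) (hab : b ≤ a) {ψ : Aut2 K}
    (hψ : ψ ∈ originGroup K a b c) (h : IsLiftable a b c ψ) : ψ ∈ (alpha K a b c).range := by
  obtain ⟨s, hs, hs'⟩ := exists_liftable_mul hb hc hab (inv_mem hψ)
  have h1 : IsLiftable a b c s := by
    have := h.mul hs'
    rwa [mul_inv_cancel_left] at this
  obtain ⟨l, rfl⟩ := eq_elemU_zero_of_liftable hb hs h1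
  refine mem_range_alpha hc h ?_
  have h2 : IsLiftable a b c (elemU l⁻¹ (0 : Polynomial K)) :=
    isLiftable_elemU hc hab _ (elemU_mem_originGroup _ admissibleU_zero) fun q hq => by simp at hq
  have := hs'.mul h2
  rwa [mul_assoc, elemU_mul, mul_inv_cancel, mul_zero, add_zero, elemU_one_zero, mul_one] at this

theorem setU_subset_range (ha : 0 < a) (hb : 0 < b) (hc : 0 < c) (hab : b ≤ a) {ψ : Aut2 K}
    (hψ : ψ ∈ setU K a b c) : ψ ∈ (alpha K a b c).range := by
  have hmem := setU_subset_originGroup ha hb hψ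
  obtain ⟨l, f, rfl, hf⟩ := (mem_setU_iff hb).1 hψ
  exact mem_range_alpha_of_liftable hb hc hab hmem
    (isLiftable_elemU hc hab l hmem fun q hq => (hf q hq).2)

theorem corrected_eq (s τ θ : Aut2 K) : corrected s τ θ = τ * θ * τ⁻¹ * s := rfl

theorem exists_isCorrection (hb : 0 < b) (hc : 0 < c) (hab : b ≤ a) {τ θ : Aut2 K}
    (hτ : τ ∈ setW K a b c) (hθ : θ ∈ setD K a b c) : ∃ s, IsCorrection a b c s τ θ := by
  have hτ' := setW_subset_originGroup hb hτ
  have h := mul_mem (mul_mem hτ' (setD_subset_originGroup hθ)) (inv_mem hτ')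
  obtain ⟨s, hs, hs'⟩ := exists_liftable_mul hb hc hab h
  exact ⟨s, hs, mem_range_alpha_of_liftable (ψ := τ * θ * τ⁻¹ * s) hb hc hab
    (mul_mem h (setW_subset_originGroup hb hs)) hs'⟩

theorem setW_mul (hb : 0 < b) {σ τ : Aut2 K} (hσ : σ ∈ setW K a b c) (hτ : τ ∈ setW K a b c) :
    σ * τ ∈ setW K a b c := by
  obtain ⟨l, f, rfl, hf⟩ := (mem_setW_iff hb).1 hσ
  obtain ⟨m, g, rfl, hg⟩ := (mem_setW_iff hb).1 hτ
  refine (mem_setW_iff hb).2 ⟨_, _, elemU_mul l m f g, fun q hq => ?_⟩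
  by_cases h : g.coeff q = 0
  · exact hf q fun h' => by simp [h, h'] at hq
  · exact hg q h

theorem setW_inv (hb : 0 < b) {σ : Aut2 K} (hσ : σ ∈ setW K a b c) : σ⁻¹ ∈ setW K a b c := by
  obtain ⟨l, f, rfl, hf⟩ := (mem_setW_iff hb).1 hσ
  exact (mem_setW_iff hb).2 ⟨_, _, elemU_inv l f, fun q hq => hf q fun h => by simp [h] at hq⟩

/-- Every product of elements of `U`, `W` and `D` is a product of generators, followed by an
element of `W`. -/
theorem elemMonoid_subset_mul (hb : 0 < b) {s : Aut2 K → Aut2 K → Aut2 K}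
    (hs : ∀ τ ∈ setW K a b c, ∀ θ ∈ setD K a b c, s τ θ ∈ setW K a b c) {ψ : Aut2 K}
    (hψ : ψ ∈ elemMonoid K a b c) :
    ∃ h ∈ Subgroup.closure (setU K a b c ∪ setS K a b c s), ∃ w ∈ setW K a b c, ψ = h * w := by
  induction hψ using Submonoid.closure_induction_right with
  | one => exact ⟨1, one_mem _, 1, one_mem_setW hb, (mul_one 1).symm⟩
  | mul_right x _ y hy ih =>
    obtain ⟨h, hh, w, hw, rfl⟩ := ih
    rcases hy with (hy | hy) | hy
    · obtain ⟨l, f, rfl, hf⟩ := (mem_setW_iff hb).1 hw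
      obtain ⟨m, g, rfl, hg⟩ := (mem_setU_iff hb).1 hy
      -- Maps of the form (lu + f(v), v) commute up to rescaling f, so the factor from U passes to
      -- the left of the one from W.
      have hu : elemU 1 (Polynomial.C (((l * m)⁻¹ : Kˣ) : K) * g) ∈ setU K a b c :=
        (mem_setU_iff hb).2 ⟨_, _, rfl, fun q hq => hg q fun h => hq (by rw [Polynomial.coeff_C_mul, h, mul_zero])⟩
      have hw' : elemU (l * m) (Polynomial.C (m : K) * f) ∈ setW K a b c :=
        (mem_setW_iff hb).2 ⟨_, _, rfl, fun q hq => hf q fun h => by simp [h] at hq⟩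
      refine ⟨_, mul_mem hh (Subgroup.subset_closure (.inl hu)), _, hw', ?_⟩
      rw [mul_assoc, mul_assoc, elemU_mul, elemU_mul, one_mul, ← mul_assoc, ← Polynomial.C_mul,
        Units.mul_inv, Polynomial.C_1, one_mul, add_comm]
    · exact ⟨h, hh, _, setW_mul hb hw hy, mul_assoc _ _ _⟩
    -- Here wy = (w y w⁻¹ s)(s⁻¹ w): a generator from S followed by an element of W.
    · refine ⟨h * corrected (s w y) w y,
        mul_mem hh (Subgroup.subset_closure (.inr ⟨w, hw, y, hy, rfl⟩)), _,
        setW_mul hb (setW_inv hb (hs w hw y hy)) hw, ?_⟩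
      rw [corrected_eq]
      group

end Corrections

/-! ### Graded automorphisms of K[x,y,z] -/

section Space

variable {K : Type*} [Field K] {a b c : ℕ}

theorem mem_gradedAut {φ : Aut3 K}
    (h : ∀ i, φ (X i) ∈ component K a b c (deg3 a b c i)) : φ ∈ gradedAut K a b c := by
  intro n p hp
  have hφ : φ p = aeval (fun i => φ (X i)) p := DFunLike.congr_fun (aeval_unique φ.toAlgHom) p
  rw [hφ]
  exact isWeightedHomogeneous_aeval h hp

/-- The diagonal automorphism `x_i ↦ l_i x_i`. -/
noncomputable def diagonal (l : Fin 3 → Kˣ) : Aut3 K :=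
  AlgEquiv.ofAlgHom (aeval fun i => C (l i : K) * X i) (aeval fun i => C ((l i)⁻¹ : Kˣ).1 * X i)
    (by
      ext1 i
      simp only [AlgHom.comp_apply, aeval_X, map_mul, algHom_C, algebraMap_eq, AlgHom.id_apply]
      rw [← mul_assoc, ← C_mul, Units.inv_mul, C_1, one_mul])
    (by
      ext1 i
      simp only [AlgHom.comp_apply, aeval_X, map_mul, algHom_C, algebraMap_eq, AlgHom.id_apply]
      rw [← mul_assoc, ← C_mul, Units.mul_inv, C_1, one_mul])

@[simp] theorem diagonal_X (l : Fin 3 → Kˣ) (i : Fin 3) :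
    diagonal l (X i) = C (l i : K) * X i := by
  simp [diagonal]

theorem diagonal_inv_X (l : Fin 3 → Kˣ) (i : Fin 3) :
    (diagonal l)⁻¹ (X i) = C ((l i)⁻¹ : Kˣ).1 * X i := by
  change (diagonal l).symm (X i) = _
  simp [diagonal]

theorem diagonal_mem_gradedAut (l : Fin 3 → Kˣ) : diagonal l ∈ gradedAut K a b c :=
  mem_gradedAut fun i => by
    rw [diagonal_X]
    exact IsWeightedHomogeneous.C_mul (X_mem_component i) _

theorem aut3_ext {φ ψ : Aut3 K} (h : ∀ i, φ (X i) = ψ (X i)) : φ = ψ := by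
  have : φ.toAlgHom = ψ.toAlgHom := by
    ext1 i
    exact h i
  exact AlgEquiv.coe_toAlgHom_injective this

theorem exists_eq_C_mul_X_of_dvd {φ : Aut3 K} {i : Fin 3} (h : X i ∣ φ (X i)) :
    ∃ l : Kˣ, φ (X i) = C (l : K) * X i := by
  have hirr : Irreducible (φ (X i)) := by
    rw [MulEquiv.irreducible_iff φ]
    exact (X_prime (i := i)).irreducible
  obtain ⟨f, hf⟩ := h
  rcases hirr.isUnit_or_isUnit hf with hu | hu
  · exact absurd hu (X_prime (i := i)).not_isUnit
  · obtain ⟨r, hr, hfr⟩ := isUnit_iff_eq_C_of_isReduced.1 hu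
    exact ⟨hr.unit, by rw [hf, hfr, mul_comm]; rfl⟩

/-- Every monomial of negative degree contains z, so z divides its own image. -/
theorem exists_apply_X_two (hc : 0 < c) {φ : Aut3 K}
    (hφ : φ ∈ gradedAut K a b c) : ∃ l : Kˣ, φ (X 2) = C (l : K) * X 2 := by
  refine exists_eq_C_mul_X_of_dvd (X_dvd_of_forall fun d hd h0 => ?_)
  have h : Finsupp.weight (deg3 a b c) d = -c := hφ _ _ X_two_mem_component hd
  rw [weight_deg3, h0] at h
  have : (0 : ℤ) ≤ ((d 0 * a + d 1 * b : ℕ) : ℤ) := Int.natCast_nonneg _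
  lia

/-- A monomial x^i z^k of degree b has i ≥ 1 and ia ≡ b mod c. If this is impossible, y divides its
own image. -/
theorem exists_apply_X_one (hb : 0 < b) (hk : ¬ ∃ k : ℕ, 1 ≤ k ∧ (k : ZMod c) * a = b)
    {φ : Aut3 K} (hφ : φ ∈ gradedAut K a b c) : ∃ l : Kˣ, φ (X 1) = C (l : K) * X 1 := by
  refine exists_eq_C_mul_X_of_dvd (X_dvd_of_forall fun d hd h1 => hk ⟨d 0, ?_, ?_⟩)
  · have h : Finsupp.weight (deg3 a b c) d = b := hφ _ _ X_one_mem_component hd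
    rw [weight_deg3, h1] at h
    by_contra! h0
    rw [show d 0 = 0 by lia] at h
    have : (0 : ℤ) ≤ ((d 2 * c : ℕ) : ℤ) := Int.natCast_nonneg _
    lia
  · have h : Finsupp.weight (deg3 a b c) d = b := hφ _ _ X_one_mem_component hd
    rw [weight_deg3, h1] at h
    have := congrArg (Int.cast : ℤ → ZMod c) h
    simpa using this

theorem isElementary_diagonal_update (i : Fin 3) (l : Kˣ) :
    IsElementary (diagonal (Function.update 1 i l)) := by
  refine ⟨i, l, 0, l.ne_zero, by simp, by simp, fun j hj => ?_⟩
  rw [diagonal_X, Function.update_of_ne hj]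
  simp

/-- Without such k, every graded automorphism only scales y and z. Dividing by these scalings leaves
an elementary automorphism in x, so all of them are tame. -/
theorem exists_modEq_of_wild (hb : 0 < b) (hc : 0 < c)
    (hwild : AdmitsGradedWild K a b c) : ∃ k : ℕ, 1 ≤ k ∧ (k : ZMod c) * a = b := by
  by_contra hk
  obtain ⟨φ, hφ, hwild⟩ := hwild
  apply hwild
  obtain ⟨l, hl⟩ := exists_apply_X_one hb hk hφ
  obtain ⟨m, hm⟩ := exists_apply_X_two hc hφ
  obtain ⟨t, ht⟩ : ∃ t : Aut3 K, t =
    diagonal (Function.update 1 1 l) * diagonal (Function.update 1 2 m) := ⟨_, rfl⟩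
  have ht' : t = diagonal ![1, l, m] := by
    rw [ht]
    refine aut3_ext fun i => ?_
    fin_cases i <;> simp [AlgEquiv.mul_apply, map_C]
  have htg : t ∈ gradedAut K a b c := ht' ▸ diagonal_mem_gradedAut _
  obtain ⟨n, F, hn, hF⟩ := exists_eq_C_mul_X_add (φ * t⁻¹) (fun j => by
    rw [ht', AlgEquiv.mul_apply, diagonal_inv_X, map_mul, map_C]
    fin_cases j
    · change C ((l⁻¹ : Kˣ) : K) * φ (X 1) = X 1
      rw [hl, ← mul_assoc, ← C_mul, Units.inv_mul, C_1, one_mul]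
    · change C ((m⁻¹ : Kˣ) : K) * φ (X 2) = X 2
      rw [hm, ← mul_assoc, ← C_mul, Units.inv_mul, C_1, one_mul])
  have he : IsElementary (φ * t⁻¹) := by
    refine ⟨0, n, rename Fin.succ F, hn, fun h => ?_, hF, fun j hj => ?_⟩
    · classical
      have := vars_rename Fin.succ F h
      obtain ⟨i, _, hi⟩ := Finset.mem_image.1 this
      exact Fin.succ_ne_zero i hi
    · rw [ht', AlgEquiv.mul_apply, diagonal_inv_X, map_mul, map_C]
      fin_cases j
      · exact absurd rfl hj
      · change C ((l⁻¹ : Kˣ) : K) * φ (X 1) = X 1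
        rw [hl, ← mul_assoc, ← C_mul, Units.inv_mul, C_1, one_mul]
      · change C ((m⁻¹ : Kˣ) : K) * φ (X 2) = X 2
        rw [hm, ← mul_assoc, ← C_mul, Units.inv_mul, C_1, one_mul]
  have h1 : φ = φ * t⁻¹ * (diagonal (Function.update 1 1 l) *
      diagonal (Function.update 1 2 m)) := by
    rw [← ht]; group
  rw [IsGradedTame, h1]
  exact mul_mem (Submonoid.subset_closure ⟨mul_mem hφ (inv_mem htg), he⟩)
    (mul_mem (Submonoid.subset_closure ⟨diagonal_mem_gradedAut _, isElementary_diagonal_update _ _⟩)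
      (Submonoid.subset_closure ⟨diagonal_mem_gradedAut _, isElementary_diagonal_update _ _⟩))

theorem torusT_subset_gradedAut {φ : Aut3 K} (h : φ ∈ torusT K) : φ ∈ gradedAut K a b c := by
  obtain ⟨l, -, h0, h1, h2⟩ := h
  refine mem_gradedAut fun i => ?_
  fin_cases i
  · change φ (X 0) ∈ _
    rw [h0]; exact X_mem_component 0
  · change φ (X 1) ∈ _
    rw [h1]; exact X_mem_component 1
  · change φ (X 2) ∈ _
    rw [h2]; exact IsWeightedHomogeneous.C_mul (X_mem_component 2) _

theorem lifts_subset_gradedAut {Z : Set (Aut2 K)} {φ : Aut3 K} (h : φ ∈ lifts K a b c Z) :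
    φ ∈ gradedAut K a b c := by
  obtain ⟨e, -, rfl⟩ := h
  exact e.2.1

theorem closure_eq_gradedAut [IsAlgClosed K] [CharZero K] (ha : 0 < a) (hb : 0 < b) (hc : 0 < c)
    (hab : b ≤ a) (hk : ∃ k : ℕ, 1 ≤ k ∧ (k : ZMod c) * a = b) (s : Aut2 K → Aut2 K → Aut2 K)
    (hs : ∀ τ ∈ setW K a b c, ∀ θ ∈ setD K a b c, IsCorrection a b c (s τ θ) τ θ) :
    Subgroup.closure (lifts K a b c (setU K a b c) ∪ lifts K a b c (setS K a b c s) ∪ torusT K) =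
      gradedAut K a b c := by
  obtain ⟨N, hN⟩ : ∃ N, N = Subgroup.closure
    (lifts K a b c (setU K a b c) ∪ lifts K a b c (setS K a b c s) ∪ torusT K) := ⟨_, rfl⟩
  have hNU : lifts K a b c (setU K a b c) ⊆ N := fun φ h =>
    hN ▸ Subgroup.subset_closure (.inl (.inl h))
  have hNS : lifts K a b c (setS K a b c s) ⊆ N := fun φ h =>
    hN ▸ Subgroup.subset_closure (.inl (.inr h))
  have hNT : torusT K ⊆ N := fun φ h => hN ▸ Subgroup.subset_closure (.inr h)
  refine le_antisymm ((Subgroup.closure_le _).2 ?_) fun φ hφ => ?_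
  · rintro φ ((h | h) | h)
    · exact lifts_subset_gradedAut h
    · exact lifts_subset_gradedAut h
    · exact torusT_subset_gradedAut h
  rw [← hN]
  obtain ⟨l, hl⟩ := exists_apply_X_two hc hφ
  have ht : diagonal ![1, 1, l] ∈ torusT K :=
    ⟨l, l.ne_zero, by simp, by simp, by simp⟩
  -- Dividing by an element of T makes φ fix z.
  let ε : groupE K a b c := ⟨φ * (diagonal ![1, 1, l])⁻¹,
    mul_mem hφ (inv_mem (diagonal_mem_gradedAut _)), by
      rw [AlgEquiv.mul_apply, diagonal_inv_X, map_mul, map_C, hl, ← mul_assoc, ← C_mul]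
      simp⟩
  have hclosure : Subgroup.closure (setU K a b c ∪ setS K a b c s) ≤
      (N.subgroupOf (groupE K a b c)).map (alpha K a b c) := by
    rw [Subgroup.closure_le]
    rintro ψ (h | h)
    · obtain ⟨e, rfl⟩ := setU_subset_range ha hb hc hab h
      exact ⟨e, hNU ⟨e, h, rfl⟩, rfl⟩
    · obtain ⟨e, he⟩ : ψ ∈ (alpha K a b c).range := by
        obtain ⟨τ, hτ, θ, hθ, rfl⟩ := h
        exact (hs τ hτ θ hθ).2
      subst he
      exact ⟨e, hNS ⟨e, h, rfl⟩, rfl⟩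
  obtain ⟨h, hh, w, hw, hhw⟩ := elemMonoid_subset_mul hb (fun τ hτ θ hθ => (hs τ hτ θ hθ).1)
    (originGroup_le_elemMonoid hb hab hk (alpha_mem_originGroup ha hb ε))
  obtain ⟨e, heN, rfl⟩ := hclosure hh
  -- The factor from W is a quotient of two elements of α(E), so it lifts and is a scaling.
  have hw' : alpha K a b c (e⁻¹ * ε) = w := by
    rw [map_mul, map_inv, hhw, inv_mul_cancel_left]
  obtain ⟨m, rfl⟩ := eq_elemU_zero_of_liftable hb hw (hw' ▸ isLiftable_alpha _)
  have hwU : alpha K a b c (e⁻¹ * ε) ∈ setU K a b c := by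
    rw [hw', mem_setU_iff hb]
    exact ⟨m, 0, rfl, fun q hq => by simp at hq⟩
  have h1 : ((e⁻¹ * ε : groupE K a b c) : Aut3 K) ∈ N := hNU ⟨_, hwU, rfl⟩
  have h2 : φ = (e : Aut3 K) * ((e⁻¹ * ε : groupE K a b c) : Aut3 K) * diagonal ![1, 1, l] := by
    rw [← Subgroup.coe_mul, mul_inv_cancel_left]
    simp [ε]
  rw [h2]
  exact mul_mem (mul_mem heN h1) (hNT ht)

/-- The witnesses are τ = (u + v², v) and θ = (u, v + u); modulo c = 1 all congruences are void. The
lift is identified by comparing restrictions to z = 1. -/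
theorem exists_nagata : ∃ τ ∈ setW K 3 1 1, ∃ θ ∈ setD K 3 1 1,
    IsCorrection 3 1 1 1 τ θ ∧
    ∃ φ ∈ lifts K 3 1 1 {corrected 1 τ θ}, IsNagata φ := by
  obtain ⟨τ, hτ⟩ : ∃ τ : Aut2 K, τ = elemU 1 (Polynomial.X ^ 2) := ⟨_, rfl⟩
  obtain ⟨θ, hθ⟩ : ∃ θ : Aut2 K, θ = elemV 1 (Polynomial.X ^ 1) := ⟨_, rfl⟩
  have hτW : τ ∈ setW K 3 1 1 := by
    refine (mem_setW_iff one_pos).2 ⟨_, _, hτ, fun q hq => ⟨Subsingleton.elim _ _, ?_⟩⟩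
    rw [Polynomial.coeff_X_pow] at hq
    split_ifs at hq with h
    · lia
    · exact absurd rfl hq
  have hθD : θ ∈ setD K 3 1 1 :=
    mem_setD_iff.2 ⟨_, _, hθ, le_rfl, Subsingleton.elim _ _⟩
  have hτ' := setW_subset_originGroup one_pos hτW
  have hmem : corrected 1 τ θ ∈ originGroup K 3 1 1 := by
    rw [corrected_eq]
    exact mul_mem (mul_mem (mul_mem hτ' (setD_subset_originGroup hθD)) (inv_mem hτ')) (one_mem _)
  have hτ0 : τ (X 0) = X 0 + X 1 ^ 2 := by rw [hτ]; simp [atV]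
  have hτ1 : τ (X 1) = X 1 := by rw [hτ]; simp
  have hθ0 : θ (X 0) = X 0 := by rw [hθ]; simp
  have hθ1 : θ (X 1) = X 1 + X 0 := by rw [hθ]; simp [atU]
  have hinv0 : τ⁻¹ (X 0) = X 0 - X 1 ^ 2 := by
    rw [hτ, elemU_inv, elemU_X_zero]
    simp [atV, sub_eq_add_neg]
  have hinv1 : τ⁻¹ (X 1) = X 1 := by rw [hτ, elemU_inv, elemU_X_one]
  have hc0 : corrected 1 τ θ (X 0) =
      X 0 + X 1 ^ 2 - (X 1 + (X 0 + X 1 ^ 2)) ^ 2 := by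
    rw [corrected_eq, mul_one, AlgEquiv.mul_apply, AlgEquiv.mul_apply, hinv0]
    simp only [map_sub, map_add, map_pow, hθ0, hθ1, hτ0, hτ1]
  have hc1 : corrected 1 τ θ (X 1) = X 1 + (X 0 + X 1 ^ 2) := by
    rw [corrected_eq, mul_one, AlgEquiv.mul_apply, AlgEquiv.mul_apply, hinv1]
    simp only [map_add, hθ1, hτ0, hτ1]
  have hx : (X 0 : MvPolynomial (Fin 3) K) ∈ component K 3 1 1 3 := X_zero_mem_component
  have hy : (X 1 : MvPolynomial (Fin 3) K) ∈ component K 3 1 1 1 := X_one_mem_component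
  have hz : (X 2 : MvPolynomial (Fin 3) K) ∈ component K 3 1 1 (-1) := X_two_mem_component
  have hw : (X 0 * X 2 + X 1 ^ 2 : MvPolynomial (Fin 3) K) ∈ component K 3 1 1 2 :=
    IsWeightedHomogeneous.add (IsWeightedHomogeneous.mul hx hz) (IsWeightedHomogeneous.pow hy 2)
  have hf : (X 0 - 2 * X 1 * (X 0 * X 2 + X 1 ^ 2) - X 2 * (X 0 * X 2 + X 1 ^ 2) ^ 2 :
      MvPolynomial (Fin 3) K) ∈ component K 3 1 1 3 := by
    refine Submodule.sub_mem _ (Submodule.sub_mem _ hx ?_)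
      (IsWeightedHomogeneous.mul hz (IsWeightedHomogeneous.pow hw 2))
    have := IsWeightedHomogeneous.C_mul (IsWeightedHomogeneous.mul hy hw) (2 : K)
    rwa [← mul_assoc] at this
  have hg : (X 1 + X 2 * (X 0 * X 2 + X 1 ^ 2) : MvPolynomial (Fin 3) K) ∈
      component K 3 1 1 1 :=
    Submodule.add_mem _ hy (IsWeightedHomogeneous.mul hz hw)
  have hrf : restrict K (X 0 - 2 * X 1 * (X 0 * X 2 + X 1 ^ 2) -
      X 2 * (X 0 * X 2 + X 1 ^ 2) ^ 2) = corrected 1 τ θ (X 0) := by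
    rw [hc0]
    simp only [map_sub, map_mul, map_add, map_pow, map_ofNat, restrict_X_zero, restrict_X_one,
      restrict_X_two]
    ring
  have hrg : restrict K (X 1 + X 2 * (X 0 * X 2 + X 1 ^ 2)) = corrected 1 τ θ (X 1) := by
    rw [hc1]
    simp only [map_mul, map_add, map_pow, restrict_X_zero, restrict_X_one, restrict_X_two]
    ring
  have hrange := mem_range_alpha_of_liftable one_pos one_pos (by norm_num) hmem
    (isLiftable_of_restrict hf hg hrf hrg)
  refine ⟨τ, hτW, θ, hθD, ⟨one_mem_setW one_pos, hrange⟩, ?_⟩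
  obtain ⟨e, he⟩ := hrange
  refine ⟨e, ⟨e, he, rfl⟩, ?_, ?_, e.2.2⟩
  · refine restrict_injOn one_pos (e.2.1 _ _ hx) hf ?_
    rw [← alpha_apply, he, restrict_X_zero, hrf]
  · refine restrict_injOn one_pos (e.2.1 _ _ hy) hg ?_
    rw [← alpha_apply, he, restrict_X_one, hrg]

end Space

end GradedAut

theorem theorem3p8 {K : Type*} [Field K] [IsAlgClosed K] [CharZero K]
    (a b c : ℕ) (ha : 0 < a) (hb : 0 < b) (hc : 0 < c)
    (hgcd : Nat.gcd a (Nat.gcd b c) = 1) (hab : b ≤ a)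
    (hwild : GradedAut.AdmitsGradedWild K a b c) :
    -- lifts are unique, and every element of `U` has one
    Function.Injective (GradedAut.alpha K a b c) ∧
    (∀ ψ ∈ GradedAut.setU K a b c, ψ ∈ (GradedAut.alpha K a b c).range) ∧
    -- the corrections exist
    (∀ τ ∈ GradedAut.setW K a b c, ∀ θ ∈ GradedAut.setD K a b c,
      ∃ s, GradedAut.IsCorrection a b c s τ θ) ∧
    -- generation of the group of graded automorphisms, for every choice of the corrections
    (∀ s : GradedAut.Aut2 K → GradedAut.Aut2 K → GradedAut.Aut2 K,
      (∀ τ ∈ GradedAut.setW K a b c, ∀ θ ∈ GradedAut.setD K a b c,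
        GradedAut.IsCorrection a b c (s τ θ) τ θ) →
      Subgroup.closure
          (GradedAut.lifts K a b c (GradedAut.setU K a b c) ∪
            GradedAut.lifts K a b c (GradedAut.setS K a b c s) ∪
            GradedAut.torusT K) =
        GradedAut.gradedAut K a b c) ∧
    -- the Nagata automorphism is one of the generators for the grading `(3, 1, -1)`
    (a = 3 → b = 1 → c = 1 →
      ∃ τ ∈ GradedAut.setW K a b c, ∃ θ ∈ GradedAut.setD K a b c,
        GradedAut.IsCorrection a b c 1 τ θ ∧
        ∃ φ ∈ GradedAut.lifts K a b c {GradedAut.corrected 1 τ θ}, GradedAut.IsNagata φ) := by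
  have hk := GradedAut.exists_modEq_of_wild hb hc hwild
  refine ⟨GradedAut.alpha_injective hc,
    fun ψ hψ => GradedAut.setU_subset_range ha hb hc hab hψ,
    fun τ hτ θ hθ => GradedAut.exists_isCorrection hb hc hab hτ hθ,
    fun s hs => GradedAut.closure_eq_gradedAut ha hb hc hab hk s hs, ?_⟩
  rintro rfl rfl rfl
  exact GradedAut.exists_nagata
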